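/- Let $\mathcal S,\mathcal A$ be finite sets with $S=|\mathcal S|$, $A=|\mathcal A|$, let $r:\mathcal S\times\mathcal A\to[0,1]$ be a known reward function, $s_0\in\mathcal S$ and $\gamma\in[0,1)$. An environment $\mathcal E$ is a transition function $\rho(\cdot\mid s,a)$. For a (stationary stochastic) policy $\pi$ with transition matrix $P_\pi$ and reward vector $r_\pi$ put $V^\gamma_{\pi,\mathcal E}=\sum_{h\ge0}\gamma^hP_\pi^hr_\pi$, $V^\gamma_{*,\mathcal E}(s)=\sup_\pi V^\gamma_{\pi,\mathcal E}(s)$, $\lambda_{\pi,\mathcal E}(s)=\liminf_{n\to\infty}\frac1n\sum_{t<n}(P_\pi^tr_\pi)(s)$, $\lambda_{*,\mathcal E}(s)=\sup_\pi\lambda_{\pi,\mathcal E}(s)$. The reward averaging time $\tau_{\pi,\mathcal E}\in[0,\infty]$ is the smallest $c$ with $\left|\sum_{t<n}(P_\pi^tr_\pi)(s)-n\lambda_{\pi,\mathcal E}(s)\right|\le c$ for all $n\ge0$, $s\in\mathcal S$, and $\tau_{*,\mathcal E}$ is the infimum of $\tau_{\pi,\mathcal E}$ over the optimal policies $\pi$,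 i.e. those with $V^\gamma_{\pi,\mathcal E}=V^\gamma_{*,\mathcal E}$ and $\lambda_{\pi,\mathcal E}=\lambda_{*,\mathcal E}$ ($\infty$ if there are none). $\mathcal E$ is weakly communicating if there is a closed set of states, each accessible from every other one under some deterministic stationary policy, and all other states are transient under every policy. Fix a measurable map $\mathcal E\mapsto\pi^{\mathcal E}$ with $V^\gamma_{\pi^{\mathcal E},\mathcal E}=V^\gamma_{*,\mathcal E}$ for every $\mathcal E$. CPSRL with discount $\gamma$: the true environment $\mathcal E$ is drawn from a prior; the steps are $t=0,1,2,\dots$, the initial state is $s_0$, and $H_t$ is the history $(S_0,A_0,\dots,A_{t-1},S_t)$. A pseudo-episode starts at step $0$ and, independently of everything before, at each later step with probability $1-\gamma$. When a pseudo-episode starts at step $t$, a fresh environment is sampled from the posterior of $\mathcal E$ given $H_t$; otherwise the previous sampled environment is kept. With $\hat{\mathcal E}_t$ the sampled environment in use at step $t$, $A_t\sim\pi^{\hat{\mathcal E}_t}(\cdot\mid S_t)$ and $S_{t+1}\sim\rho(\cdot\mid S_t,A_t)$, $\rho$ the true transition function. For a positive integer $T$ let $$\mathrm{Regret}_\gamma(T)=\sum_{k=1}^K\left(V^\gamma_{*,\mathcal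 E}(S_{t_k})-V^\gamma_{\pi_k,\mathcal E}(S_{t_k})\right),$$ where $t_1<\dots<t_K$ are the steps among the first $T$ (i.e. $0,\dots,T-1$) at which a pseudo-episode starts and $\pi_k=\pi^{\hat{\mathcal E}_{t_k}}$. Theorem. Suppose that for some $\tau\in[0,\infty)$, almost surely under the prior, $\mathcal E$ is weakly communicating and $\tau_{*,\mathcal E}\le\tau$. Then for every integer $T\ge1$ with $\frac1{1-\gamma}\log\frac{2T}{1-\gamma}\ge1$ (which holds whenever $T\ge2$), $\mathrm{Regret}_\gamma(T)$ is integrable and $$\mathbb E\left[\mathrm{Regret}_\gamma(T)\right]\le(4\tau+2)S\sqrt{28AT\log(2SAT)}+\frac{SA}{1-\gamma}\log\left(\frac1{1-\gamma}\log\frac{2T}{1-\gamma}\right)+\frac12+\frac2{1-\gamma}.$$ -/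

import Mathlib

open MeasureTheory ProbabilityTheory Filter
open scoped NNReal ENNReal

noncomputable section

namespace CPSRL

/-! ### Finite Markov decision processes with known rewards -/

/-- An environment with finite state space `St` and finite action space `Ac`: a transition
function `ρ(· ∣ s, a)`, that is, a probability vector on `St` for every state-action pair.
As a subtype of a product of copies of `ℝ` it carries the Borel σ-algebra. -/
abbrev Env (St Ac : Type*) [Fintype St] : Type _ := St → Ac → stdSimplex ℝ St

/-- A (stationary, stochastic) policy: a probability vector on `Ac` for every state. -/
abbrev Policy (St Ac : Type*) [Fintype Ac] : Type _ := St → stdSimplex ℝ Ac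

section MDP

variable {St Ac : Type*} [Fintype St] [Fintype Ac] [DecidableEq St]

/-- The transition probability `ρ(s' ∣ s, a)`. -/
def Env.prob (M : Env St Ac) (s : St) (a : Ac) (s' : St) : ℝ := (M s a).1 s'

/-- The probability `π(a ∣ s)`. -/
def Policy.prob (π : Policy St Ac) (s : St) (a : Ac) : ℝ := (π s).1 a

/-- The deterministic stationary policy that plays `f s` in state `s`. -/
def Policy.det [DecidableEq Ac] (f : St → Ac) : Policy St Ac :=
  fun s => ⟨Pi.single (f s) 1, single_mem_stdSimplex ℝ (f s)⟩

/-- The transition matrix `P_π` of the Markov chain induced by `π`. -/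
def transMat (M : Env St Ac) (π : Policy St Ac) : Matrix St St ℝ :=
  fun s s' => ∑ a, π.prob s a * M.prob s a s'

/-- The vector `r_π` of expected one-step rewards under `π`. -/
def rewardVec (r : St → Ac → ℝ) (π : Policy St Ac) : St → ℝ :=
  fun s => ∑ a, π.prob s a * r s a

/-- The expected reward of step `t` when `π` is followed from the state `s`:
`𝔼_π[R_{t+1} ∣ M, S_0 = s] = (P_π ^ t r_π)(s)`. -/
def expReward (r : St → Ac → ℝ) (M : Env St Ac) (π : Policy St Ac) (t : ℕ) (s : St) : ℝ :=
  ((transMat M π ^ t).mulVec (rewardVec r π)) s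

/-- The `γ`-discounted value `V^γ_{π,M}(s) = ∑_h γ^h (P_π^h r_π)(s)`. -/
def discValue (γ : ℝ) (r : St → Ac → ℝ) (M : Env St Ac) (π : Policy St Ac) (s : St) : ℝ :=
  ∑' h : ℕ, γ ^ h * expReward r M π h s

/-- The optimal `γ`-discounted value `V^γ_{*,M}(s)`. -/
def optDiscValue (γ : ℝ) (r : St → Ac → ℝ) (M : Env St Ac) (s : St) : ℝ :=
  ⨆ π : Policy St Ac, discValue γ r M π s

/-- `π` attains the optimal `γ`-discounted value in every state. -/
def IsDiscOptimal (γ : ℝ) (r : St → Ac → ℝ) (M : Env St Ac) (π : Policy St Ac) : Prop :=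
  ∀ s, discValue γ r M π s = optDiscValue γ r M s

/-- The average reward `λ_{π,M}(s)`. -/
def avgReward (r : St → Ac → ℝ) (M : Env St Ac) (π : Policy St Ac) (s : St) : ℝ :=
  liminf (fun n : ℕ => (1 / (n : ℝ)) * ∑ t ∈ Finset.range n, expReward r M π t s) atTop

/-- The optimal average reward `λ_{*,M}(s)`. -/
def optAvgReward (r : St → Ac → ℝ) (M : Env St Ac) (s : St) : ℝ :=
  ⨆ π : Policy St Ac, avgReward r M π s

/-- `π` attains the optimal average reward in every state. -/
def IsAvgOptimal (r : St → Ac → ℝ) (M : Env St Ac) (π : Policy St Ac) : Prop :=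
  ∀ s, avgReward r M π s = optAvgReward r M s

/-- The reward averaging time `τ_{π,M}`: the smallest `c ∈ [0, ∞)` with
`|𝔼_π[∑_{t < n} R_{t+1} ∣ M, S_0 = s] - n λ_{π,M}(s)| ≤ c` for all `n` and `s`
(and `∞` if there is no such `c`). -/
def rewardAvgTime (r : St → Ac → ℝ) (M : Env St Ac) (π : Policy St Ac) : ℝ≥0∞ :=
  ⨅ (c : ℝ≥0) (_ : ∀ (n : ℕ) (s : St),
    |∑ t ∈ Finset.range n, expReward r M π t s - n * avgReward r M π s| ≤ c), (c : ℝ≥0∞)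

/-- The reward averaging time `τ_{*,M}` of an optimal policy. An optimal policy is one that
attains both `V^γ_{*,M}` and `λ_{*,M}`; if there are several, the smallest averaging time is
taken, and if there is none the value is `∞`. -/
def optRewardAvgTime (γ : ℝ) (r : St → Ac → ℝ) (M : Env St Ac) : ℝ≥0∞ :=
  ⨅ (π : Policy St Ac) (_ : IsDiscOptimal γ r M π ∧ IsAvgOptimal r M π), rewardAvgTime r M π

/-- `s` is transient for the chain of `π`: the expected number of visits to `s`, started
from `s`, is finite. -/
def IsTransientState (M : Env St Ac) (π : Policy St Ac) (s : St) : Prop :=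
  Summable fun n : ℕ => (transMat M π ^ n) s s

/-- `M` is weakly communicating: there is a closed set of states, each of which is accessible
from every other one under some deterministic stationary policy, and all remaining states are
transient under every policy. -/
def IsWeaklyCommunicating [DecidableEq Ac] (M : Env St Ac) : Prop :=
  ∃ C : Set St,
    (∀ s ∈ C, ∀ a, ∀ s' ∉ C, M.prob s a s' = 0) ∧
    (∀ s ∈ C, ∀ s' ∈ C, s ≠ s' →
      ∃ (f : St → Ac) (n : ℕ), 0 < (transMat M (Policy.det f) ^ n) s s') ∧
    (∀ s ∉ C, ∀ π : Policy St Ac, IsTransientState M π s)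

end MDP

/-! ### The interaction

Time steps are numbered `0, 1, 2, …`; the first `T` steps are `0, …, T - 1`. The random
variables are the true environment `E`, the environment `samp t` in use at step `t`, the
indicator `X t` (`false` means that a new pseudo-episode starts at step `t`), the state `S t`
and the action `A t`. -/

section Interaction

variable {Ω St Ac : Type*} [Fintype St] [Fintype Ac] [DecidableEq St]
  [MeasurableSpace St] [MeasurableSpace Ac]

/-- The σ-algebra of the history `H_t = (S_0, A_0, S_1, …, A_{t-1}, S_t)`. -/
@[reducible] def histSigma (S : ℕ → Ω → St) (A : ℕ → Ω → Ac) : ℕ → MeasurableSpace Ω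
  | 0 => MeasurableSpace.comap (S 0) inferInstance
  | t + 1 => histSigma S A t ⊔ MeasurableSpace.comap (A t) inferInstance ⊔
      MeasurableSpace.comap (S (t + 1)) inferInstance

/-- The σ-algebra of everything realised before the environment `samp t` is chosen: the true
environment, `S_0, …, S_t`, `X_0, …, X_t`, `A_0, …, A_{t-1}`, `samp 0, …, samp (t - 1)`. -/
@[reducible] def pastSigma (E : Ω → Env St Ac) (samp : ℕ → Ω → Env St Ac) (X : ℕ → Ω → Bool)
    (S : ℕ → Ω → St) (A : ℕ → Ω → Ac) : ℕ → MeasurableSpace Ω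
  | 0 => MeasurableSpace.comap E inferInstance ⊔ MeasurableSpace.comap (S 0) inferInstance ⊔
      MeasurableSpace.comap (X 0) inferInstance
  | t + 1 => pastSigma E samp X S A t ⊔ MeasurableSpace.comap (samp t) inferInstance ⊔
      MeasurableSpace.comap (A t) inferInstance ⊔
      MeasurableSpace.comap (S (t + 1)) inferInstance ⊔
      MeasurableSpace.comap (X (t + 1)) inferInstance

/-- `pastSigma` at step `t`, together with `samp t`. -/
@[reducible] def preActionSigma (E : Ω → Env St Ac) (samp : ℕ → Ω → Env St Ac) (X : ℕ → Ω → Bool)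
    (S : ℕ → Ω → St) (A : ℕ → Ω → Ac) (t : ℕ) : MeasurableSpace Ω :=
  pastSigma E samp X S A t ⊔ MeasurableSpace.comap (samp t) inferInstance

/-- `pastSigma` at step `t`, together with `samp t` and `A_t`. -/
@[reducible] def preTransitionSigma (E : Ω → Env St Ac) (samp : ℕ → Ω → Env St Ac) (X : ℕ → Ω → Bool)
    (S : ℕ → Ω → St) (A : ℕ → Ω → Ac) (t : ℕ) : MeasurableSpace Ω :=
  preActionSigma E samp X S A t ⊔ MeasurableSpace.comap (A t) inferInstance

/-- `pastSigma` at step `t`, together with `samp t`, `A_t` and `S_{t+1}`. -/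
@[reducible] def preCoinSigma (E : Ω → Env St Ac) (samp : ℕ → Ω → Env St Ac) (X : ℕ → Ω → Bool)
    (S : ℕ → Ω → St) (A : ℕ → Ω → Ac) (t : ℕ) : MeasurableSpace Ω :=
  preTransitionSigma E samp X S A t ⊔ MeasurableSpace.comap (S (t + 1)) inferInstance

/-- The random variables `E, samp, X, S, A` are a run of CPSRL with the discount factor `γ`, the
given prior, the initial state `s₀` and the planner `M ↦ π^M`. -/
structure IsRun [MeasurableSpace Ω] (P : Measure Ω) (γ : ℝ) (prior : Measure (Env St Ac))
    (s₀ : St) (planner : Env St Ac → Policy St Ac)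
    (E : Ω → Env St Ac) (samp : ℕ → Ω → Env St Ac) (X : ℕ → Ω → Bool)
    (S : ℕ → Ω → St) (A : ℕ → Ω → Ac) : Prop where
  measurable_env : Measurable E
  measurable_samp : ∀ t, Measurable (samp t)
  measurable_coin : ∀ t, Measurable (X t)
  measurable_state : ∀ t, Measurable (S t)
  measurable_action : ∀ t, Measurable (A t)
  /-- the true environment is drawn from the prior -/
  env_law : Measure.map E P = prior
  init_state : ∀ᵐ ω ∂P, S 0 ω = s₀
  /-- a pseudo-episode starts at the first step -/
  init_coin : ∀ᵐ ω ∂P, X 0 ω = false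
  /-- at the start of a pseudo-episode a fresh environment is drawn from the posterior
  distribution of the true environment given the history `H_t` -/
  samp_law : ∀ (t : ℕ) (B : Set (Env St Ac)), MeasurableSet B →
    ∀ᵐ ω ∂P, X t ω = false →
      (P⟦samp t ⁻¹' B | pastSigma E samp X S A t⟧) ω = (P⟦E ⁻¹' B | histSigma S A t⟧) ω
  /-- within a pseudo-episode the sampled environment is kept -/
  samp_keep : ∀ t : ℕ, ∀ᵐ ω ∂P, X (t + 1) ω = true → samp (t + 1) ω = samp t ω
  /-- `A_t` is drawn from the policy computed for the sampled environment -/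
  action_law : ∀ (t : ℕ) (a : Ac),
    P⟦A t ⁻¹' {a} | preActionSigma E samp X S A t⟧
      =ᵐ[P] fun ω => (planner (samp t ω)).prob (S t ω) a
  /-- `S_{t+1}` is drawn from the true transition law -/
  state_law : ∀ (t : ℕ) (s' : St),
    P⟦S (t + 1) ⁻¹' {s'} | preTransitionSigma E samp X S A t⟧
      =ᵐ[P] fun ω => (E ω).prob (S t ω) (A t ω) s'
  /-- `X_{t+1}` is a Bernoulli(`γ`) variable independent of everything before it -/
  coin_law : ∀ t : ℕ,
    P⟦X (t + 1) ⁻¹' {true} | preCoinSigma E samp X S A t⟧ =ᵐ[P] fun _ => γ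

/-- The `γ`-discounted regret over the first `T` steps: the sum of
`V^γ_{*,E}(S_t) - V^γ_{π,E}(S_t)`, with `π` the policy computed at step `t`, over the steps `t`
among the first `T` at which a pseudo-episode starts. -/
def discRegret (γ : ℝ) (r : St → Ac → ℝ) (planner : Env St Ac → Policy St Ac)
    (E : Ω → Env St Ac) (samp : ℕ → Ω → Env St Ac) (X : ℕ → Ω → Bool)
    (S : ℕ → Ω → St) (T : ℕ) (ω : Ω) : ℝ :=
  ∑ t ∈ (Finset.range T).filter (fun t => X t ω = false),
    (optDiscValue γ r (E ω) (S t ω) - discValue γ r (E ω) (planner (samp t ω)) (S t ω))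

end Interaction

end CPSRL

end

/-!
The regret of posterior sampling is a sum over pseudo-episodes. At the start of a pseudo-episode
the sampled environment has the same law given the history as the true one
(`IsRun.map_samp_eq_map_env`), so in expectation the optimal value of the true environment may be
replaced by that of the sampled one, and the regret becomes a sum of value gaps `gap` of one policy
in two environments (`integral_discRegret`).

The length of a pseudo-episode is geometric with parameter `γ`, independently of everything else.
Hence the discount factor in the Bellman equation of the value gap is the probability that the
pseudo-episode goes on (`integral_gap_step`), and the value gap at its start is the expected sum,
over its steps, of `γ` times the errors `modelErr` of the sampled transition law applied to the
value function. The telescoping is stopped early, at the cost of one residual gap of size at most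
`1 / (1 - γ)`, when a step is no longer `active` (`integral_discRegret_le`): one of the two
environments lies outside of the confidence set `confSet` at the start, the pseudo-episode is older
than `m = log (2 T / (1 - γ)) / (1 - γ)`, or some number of visits has quadrupled since the start.
* The first has small probability by a supermartingale bound and a union over sign vectors
  (`IsRun.prob_notMem_confSet_le`), applied to both environments by posterior sampling.
* The second has small probability by the geometric tail (`IsRun.prob_age_le`).
* Given that the pseudo-episode is not that old, the third happens at most `log m` times for each
  state-action pair (`card_quadrupling_le_log`).

On active steps the model error is at most `τ` times the `ℓ¹`-distance of two transition laws in
the confidence set, of order `1 / √N` for the current number `N` of visits, and these terms sum to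
`O(√(S A T))` (`sum_inv_sqrt_count_le`). The factor `τ` comes from
`exists_abs_optDiscValue_sub_le`: by Abel summation the value of an optimal policy is within its
reward averaging time of `λ / (1 - γ)`, where `λ` is the optimal average reward. That `λ` does not
depend on the state is shown with a deterministic policy that is discount optimal for discount
factors tending to `1`: its average reward is optimal and no action increases it in expectation, so
it is constant on the closed communicating class, and its extremal values over all states are taken
on that class since closed sets contain non-transient states.
-/

noncomputable section

namespace CPSRL

set_option linter.unusedSectionVars false

/-! ### Stationary policies: Bellman equations and average reward -/

section Analysis

variable {St Ac : Type*} [Fintype St] [Fintype Ac]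

lemma Env.prob_nonneg (M : Env St Ac) (s : St) (a : Ac) (s' : St) : 0 ≤ M.prob s a s' :=
  (M s a).2.1 s'

lemma Env.sum_prob (M : Env St Ac) (s : St) (a : Ac) : ∑ s', M.prob s a s' = 1 :=
  (M s a).2.2

lemma Policy.prob_nonneg (π : Policy St Ac) (s : St) (a : Ac) : 0 ≤ π.prob s a :=
  (π s).2.1 a

lemma Policy.sum_prob (π : Policy St Ac) (s : St) : ∑ a, π.prob s a = 1 :=
  (π s).2.2

lemma transMat_nonneg (M : Env St Ac) (π : Policy St Ac) (s s' : St) : 0 ≤ transMat M π s s' :=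
  Finset.sum_nonneg fun a _ => mul_nonneg (π.prob_nonneg s a) (M.prob_nonneg s a s')

lemma transMat_sum (M : Env St Ac) (π : Policy St Ac) (s : St) :
    ∑ s', transMat M π s s' = 1 := by
  simp only [transMat]
  rw [Finset.sum_comm]
  simp [← Finset.mul_sum, M.sum_prob, π.sum_prob]

lemma transMat_mulVec (M : Env St Ac) (π : Policy St Ac) (v : St → ℝ) (s : St) :
    (transMat M π).mulVec v s = ∑ a, π.prob s a * ∑ s', M.prob s a s' * v s' := by
  simp only [Matrix.mulVec, dotProduct, transMat, Finset.sum_mul, Finset.mul_sum]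
  rw [Finset.sum_comm]
  simp [mul_assoc]

section Stochastic

/-! A matrix with nonnegative entries and row sums `1` averages the entries of a vector. -/

variable {Q : Matrix St St ℝ} (h0 : ∀ s s', 0 ≤ Q s s') (h1 : ∀ s, ∑ s', Q s s' = 1)
include h0 in
lemma mulVec_mono_of_nonneg {v w : St → ℝ} (h : ∀ s, v s ≤ w s) (s : St) :
    Q.mulVec v s ≤ Q.mulVec w s :=
  Finset.sum_le_sum fun s' _ => mul_le_mul_of_nonneg_left (h s') (h0 s s')

include h1 in
lemma mulVec_const_of_sum (c : ℝ) (s : St) : Q.mulVec (fun _ => c) s = c := by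
  simp [Matrix.mulVec, dotProduct, ← Finset.sum_mul, h1]

include h0 h1 in
lemma mulVec_le_of_le {v : St → ℝ} {c : ℝ} (h : ∀ s, v s ≤ c) (s : St) : Q.mulVec v s ≤ c :=
  (mulVec_mono_of_nonneg h0 h s).trans_eq (mulVec_const_of_sum h1 c s)

include h0 h1 in
lemma le_mulVec_of_le {v : St → ℝ} {c : ℝ} (h : ∀ s, c ≤ v s) (s : St) : c ≤ Q.mulVec v s :=
  (mulVec_const_of_sum h1 c s).symm.le.trans (mulVec_mono_of_nonneg h0 h s)

end Stochastic

variable [DecidableEq St]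

lemma transMat_pow_nonneg (M : Env St Ac) (π : Policy St Ac) (n : ℕ) (s s' : St) :
    0 ≤ (transMat M π ^ n) s s' := by
  induction n generalizing s s' with
  | zero => rw [pow_zero, Matrix.one_apply]; split_ifs <;> norm_num
  | succ n ih =>
    rw [pow_succ, Matrix.mul_apply]
    exact Finset.sum_nonneg fun x _ => mul_nonneg (ih _ _) (transMat_nonneg M π _ _)

lemma transMat_pow_sum (M : Env St Ac) (π : Policy St Ac) (n : ℕ) (s : St) :
    ∑ s', (transMat M π ^ n) s s' = 1 := by
  induction n generalizing s with
  | zero => simp [Matrix.one_apply]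
  | succ n ih =>
    simp only [pow_succ, Matrix.mul_apply]
    rw [Finset.sum_comm]
    simp [← Finset.mul_sum, transMat_sum, ih]

lemma rewardVec_mem {r : St → Ac → ℝ} (hr : ∀ s a, r s a ∈ Set.Icc (0 : ℝ) 1)
    (π : Policy St Ac) (s : St) : rewardVec r π s ∈ Set.Icc (0 : ℝ) 1 := by
  refine ⟨Finset.sum_nonneg fun a _ => mul_nonneg (π.prob_nonneg s a) (hr s a).1, ?_⟩
  calc rewardVec r π s ≤ ∑ a, π.prob s a * 1 :=
        Finset.sum_le_sum fun a _ => mul_le_mul_of_nonneg_left (hr s a).2 (π.prob_nonneg s a)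
    _ = 1 := by simp [π.sum_prob]

lemma expReward_mem {r : St → Ac → ℝ} (hr : ∀ s a, r s a ∈ Set.Icc (0 : ℝ) 1)
    (M : Env St Ac) (π : Policy St Ac) (t : ℕ) (s : St) :
    expReward r M π t s ∈ Set.Icc (0 : ℝ) 1 :=
  ⟨le_mulVec_of_le (transMat_pow_nonneg M π t) (transMat_pow_sum M π t)
      (fun s => (rewardVec_mem hr π s).1) s,
    mulVec_le_of_le (transMat_pow_nonneg M π t) (transMat_pow_sum M π t)
      (fun s => (rewardVec_mem hr π s).2) s⟩

lemma expReward_succ (r : St → Ac → ℝ) (M : Env St Ac) (π : Policy St Ac) (t : ℕ) :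
    expReward r M π (t + 1) = (transMat M π).mulVec (expReward r M π t) := by
  funext s
  have : expReward r M π t = (transMat M π ^ t).mulVec (rewardVec r π) := rfl
  rw [this, Matrix.mulVec_mulVec, ← pow_succ']
  rfl

lemma summable_discounted {β : ℝ} (h0 : 0 ≤ β) (h1 : β < 1) {x : ℕ → ℝ} {c : ℝ}
    (hx : ∀ n, |x n| ≤ c) : Summable fun n => β ^ n * x n := by
  refine Summable.of_norm_bounded ((summable_geometric_of_lt_one h0 h1).mul_right c) fun n => ?_
  rw [norm_mul, norm_pow, Real.norm_of_nonneg h0]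
  exact mul_le_mul_of_nonneg_left (hx n) (pow_nonneg h0 n)

lemma abs_tsum_discounted_le {β : ℝ} (h0 : 0 ≤ β) (h1 : β < 1) {x : ℕ → ℝ} {c : ℝ}
    (hx : ∀ n, |x n| ≤ c) : |∑' n, β ^ n * x n| ≤ c / (1 - β) := by
  have h := tsum_of_norm_bounded ((hasSum_geometric_of_lt_one h0 h1).mul_right c)
    (f := fun n => β ^ n * x n) fun n => by
      rw [norm_mul, norm_pow, Real.norm_of_nonneg h0]
      exact mul_le_mul_of_nonneg_left (hx n) (pow_nonneg h0 n)
  rw [div_eq_inv_mul]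
  exact h

section Discounted

variable {β : ℝ} (h0 : 0 ≤ β) (h1 : β < 1) {r : St → Ac → ℝ}
  (hr : ∀ s a, r s a ∈ Set.Icc (0 : ℝ) 1) (M : Env St Ac) (π : Policy St Ac)
include h0 h1 hr

omit h0 h1 in
lemma abs_expReward_le (t : ℕ) (s : St) : |expReward r M π t s| ≤ 1 := by
  rw [abs_of_nonneg (expReward_mem hr M π t s).1]
  exact (expReward_mem hr M π t s).2

lemma summable_discValue (s : St) : Summable fun h : ℕ => β ^ h * expReward r M π h s :=
  summable_discounted h0 h1 fun t => abs_expReward_le hr M π t s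

lemma discValue_mem (s : St) : discValue β r M π s ∈ Set.Icc 0 (1 / (1 - β)) :=
  ⟨tsum_nonneg fun h => mul_nonneg (pow_nonneg h0 h) (expReward_mem hr M π h s).1,
    (le_abs_self _).trans
      (abs_tsum_discounted_le h0 h1 fun t => abs_expReward_le hr M π t s)⟩

/-- The Bellman equation of a stationary policy. -/
lemma discValue_eq (s : St) : discValue β r M π s =
    rewardVec r π s + β * (transMat M π).mulVec (discValue β r M π) s := by
  have hs := summable_discValue h0 h1 hr M π
  have h : (transMat M π).mulVec (discValue β r M π) s
      = ∑' h : ℕ, β ^ h * expReward r M π (h + 1) s := by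
    simp only [expReward_succ, Matrix.mulVec, dotProduct, discValue, Finset.mul_sum]
    rw [Summable.tsum_finsetSum fun s' _ => by
      simpa [mul_left_comm] using (hs s').mul_left (transMat M π s s')]
    refine Finset.sum_congr rfl fun s' _ => ?_
    rw [← tsum_mul_left]
    exact tsum_congr fun h => by ring
  rw [h, ← tsum_mul_left, discValue, (hs s).tsum_eq_zero_add]
  congr 1
  · simp [expReward]
  · exact tsum_congr fun h => by ring

end Discounted

omit [DecidableEq St] in
/-- A vector that decreases at most by the factor `β` under averaging is nonnegative. -/
lemma nonneg_of_discounted_le {β : ℝ} (h0 : 0 ≤ β) (h1 : β < 1) {Q : Matrix St St ℝ}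
    (hQ0 : ∀ s s', 0 ≤ Q s s') (hQ1 : ∀ s, ∑ s', Q s s' = 1) {v : St → ℝ}
    (h : ∀ s, β * Q.mulVec v s ≤ v s) (s : St) : 0 ≤ v s := by
  have : Nonempty St := ⟨s⟩
  obtain ⟨m, hm⟩ := Finite.exists_min v
  have := le_mulVec_of_le hQ0 hQ1 hm m
  have h2 := h m
  have : 0 ≤ v m := by nlinarith [mul_le_mul_of_nonneg_left this h0]
  exact this.trans (hm s)

section Comparison

variable {β : ℝ} (h0 : 0 ≤ β) (h1 : β < 1) {r : St → Ac → ℝ}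
  (hr : ∀ s a, r s a ∈ Set.Icc (0 : ℝ) 1) (M : Env St Ac) (π : Policy St Ac)
include h0 h1 hr

lemma le_discValue {v : St → ℝ}
    (hv : ∀ s, v s ≤ rewardVec r π s + β * (transMat M π).mulVec v s) (s : St) :
    v s ≤ discValue β r M π s := by
  have := nonneg_of_discounted_le h0 h1 (transMat_nonneg M π) (transMat_sum M π)
    (v := discValue β r M π - v) (fun s => by
      have := discValue_eq h0 h1 hr M π s
      have h2 := hv s
      rw [Matrix.mulVec_sub]
      simp only [Pi.sub_apply]
      linarith) s
  simpa using this

lemma discValue_le {v : St → ℝ}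
    (hv : ∀ s, rewardVec r π s + β * (transMat M π).mulVec v s ≤ v s) (s : St) :
    discValue β r M π s ≤ v s := by
  have := nonneg_of_discounted_le h0 h1 (transMat_nonneg M π) (transMat_sum M π)
    (v := v - discValue β r M π) (fun s => by
      have := discValue_eq h0 h1 hr M π s
      have h2 := hv s
      rw [Matrix.mulVec_sub]
      simp only [Pi.sub_apply]
      linarith) s
  simpa using this

end Comparison

/-- Abel summation: if the partial sums of `x` stay within `c` of `n * l`, then the discounted sum
of `x` is within `c` of `l / (1 - β)`. -/
lemma abs_discounted_sub_le {β : ℝ} (h0 : 0 ≤ β) (h1 : β < 1) {x : ℕ → ℝ} {l c : ℝ}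
    (hx : ∀ n, |∑ t ∈ Finset.range n, x t - n * l| ≤ c) :
    |∑' n, β ^ n * x n - l / (1 - β)| ≤ c := by
  set Y : ℕ → ℝ := fun n => ∑ t ∈ Finset.range n, x t - n * l with hY
  have hb : 0 < 1 - β := by linarith
  have hsY : Summable fun n => β ^ n * Y n := summable_discounted h0 h1 hx
  have hsY1 : Summable fun n => β ^ n * Y (n + 1) := summable_discounted h0 h1 fun n => hx (n + 1)
  have hxY : ∀ n, β ^ n * x n = β ^ n * Y (n + 1) - β ^ n * Y n + β ^ n * l := fun n => by
    simp only [hY, Finset.sum_range_succ]; push_cast; ring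
  have e1 : ∑' n, β ^ n * Y n = β * ∑' n, β ^ n * Y (n + 1) := by
    rw [hsY.tsum_eq_zero_add, ← tsum_mul_left]
    simp only [hY, Finset.range_zero, Finset.sum_empty]
    rw [show (β ^ 0 * (0 - ((0 : ℕ) : ℝ) * l)) = 0 by simp, zero_add]
    exact tsum_congr fun n => by ring
  have e2 : ∑' n, β ^ n * x n - l / (1 - β) = (1 - β) * ∑' n, β ^ n * Y (n + 1) := by
    rw [tsum_congr hxY, ((hsY1.sub hsY).tsum_add ((summable_geometric_of_lt_one h0 h1).mul_right l)),
      hsY1.tsum_sub hsY, e1, tsum_mul_right, tsum_geometric_of_lt_one h0 h1]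
    field_simp
    ring
  rw [e2, abs_mul, abs_of_pos hb]
  calc (1 - β) * |∑' n, β ^ n * Y (n + 1)| ≤ (1 - β) * (c / (1 - β)) :=
        mul_le_mul_of_nonneg_left (abs_tsum_discounted_le h0 h1 fun n => hx (n + 1)) hb.le
    _ = c := by field_simp

/-- For every policy the reward vector splits as `u + (1 - P) w` with `P u = u`. The kernel and
the range of `1 - P` are complementary because the powers of `P` are bounded. -/
lemma exists_poisson (r : St → Ac → ℝ) (M : Env St Ac) (π : Policy St Ac) :
    ∃ u w : St → ℝ, (transMat M π).mulVec u = u ∧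
      rewardVec r π = u + (w - (transMat M π).mulVec w) := by
  set Q := transMat M π with hQ
  set L : (St → ℝ) →ₗ[ℝ] (St → ℝ) := LinearMap.id - Q.mulVecLin with hL
  have hLa : ∀ v, L v = v - Q.mulVec v := fun v => by simp [hL]
  have hdisj : Disjoint (LinearMap.ker L) (LinearMap.range L) := by
    rw [Submodule.disjoint_def]
    rintro y hy ⟨x, rfl⟩
    have hy' : Q.mulVec (L x) = L x := by
      have := LinearMap.mem_ker.1 hy
      rw [hLa (L x), sub_eq_zero] at this
      exact this.symm
    have hpow : ∀ n : ℕ, (Q ^ n).mulVec x = x - (n : ℝ) • L x := by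
      intro n
      induction n with
      | zero => simp
      | succ n ih =>
        rw [pow_succ', ← Matrix.mulVec_mulVec, ih, Matrix.mulVec_sub, Matrix.mulVec_smul, hy']
        have : Q.mulVec x = x - L x := by rw [hLa]; abel
        rw [this]; push_cast; rw [add_smul, one_smul]; abel
    obtain ⟨b, hb⟩ : ∃ b : ℝ, ∀ s, |x s| ≤ b :=
      ⟨∑ s, |x s|, fun s => Finset.single_le_sum (fun i _ => abs_nonneg (x i)) (Finset.mem_univ s)⟩
    funext s
    by_contra hne
    have hpos : 0 < |L x s| := abs_pos.2 hne
    obtain ⟨n, hn⟩ := exists_nat_gt (2 * b / |L x s|)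
    have hup := mulVec_le_of_le (transMat_pow_nonneg M π n) (transMat_pow_sum M π n)
      (fun s => (abs_le.1 (hb s)).2) s
    have hlo := le_mulVec_of_le (transMat_pow_nonneg M π n) (transMat_pow_sum M π n)
      (fun s => (abs_le.1 (hb s)).1) s
    rw [← hQ, hpow n] at hup hlo
    simp only [Pi.sub_apply, Pi.smul_apply, smul_eq_mul] at hup hlo
    have hxs := abs_le.1 (hb s)
    have : |(n : ℝ) * L x s| ≤ 2 * b := abs_le.2 ⟨by linarith, by linarith⟩
    rw [abs_mul, Nat.abs_cast] at this
    rw [div_lt_iff₀ hpos] at hn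
    linarith
  have htop : LinearMap.ker L ⊔ LinearMap.range L = ⊤ := by
    refine Submodule.eq_top_of_disjoint _ _ ?_ hdisj
    rw [add_comm, LinearMap.finrank_range_add_finrank_ker]
  have hmem : rewardVec r π ∈ LinearMap.ker L ⊔ LinearMap.range L := htop ▸ Submodule.mem_top
  obtain ⟨u, hu, v, ⟨w, rfl⟩, huv⟩ := Submodule.mem_sup.1 hmem
  refine ⟨u, w, ?_, ?_⟩
  · have := LinearMap.mem_ker.1 hu
    rw [hLa, sub_eq_zero] at this
    exact this.symm
  · rw [← huv, hLa]

/-- If the partial sums of the expected rewards stay within a constant of `n * l`, then `l` is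
the average reward. -/
lemma avgReward_eq_of_bounded {r : St → Ac → ℝ} {M : Env St Ac} {π : Policy St Ac} {s : St}
    {l c : ℝ} (h : ∀ n : ℕ, |∑ t ∈ Finset.range n, expReward r M π t s - n * l| ≤ c) :
    avgReward r M π s = l := by
  refine Tendsto.liminf_eq ?_
  have hc : Tendsto (fun n : ℕ => c * (n : ℝ)⁻¹) atTop (nhds 0) := by
    simpa using (tendsto_inv_atTop_zero.comp tendsto_natCast_atTop_atTop).const_mul c
  rw [tendsto_iff_norm_sub_tendsto_zero]
  refine squeeze_zero' (Eventually.of_forall fun n => norm_nonneg _) ?_ hc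
  filter_upwards [eventually_gt_atTop 0] with n hn
  have hn' : (0 : ℝ) < n := by exact_mod_cast hn
  have : (1 / (n : ℝ)) * ∑ t ∈ Finset.range n, expReward r M π t s - l
      = (∑ t ∈ Finset.range n, expReward r M π t s - n * l) * (n : ℝ)⁻¹ := by
    field_simp
  rw [this, norm_mul, Real.norm_of_nonneg (inv_nonneg.2 hn'.le)]
  exact mul_le_mul_of_nonneg_right (h n) (inv_nonneg.2 hn'.le)

/-- The average reward of a stationary policy is invariant under its transition matrix, and the
expected total rewards stay within a constant of the average ones. -/
lemma avgReward_spec (r : St → Ac → ℝ) (M : Env St Ac) (π : Policy St Ac) :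
    (transMat M π).mulVec (avgReward r M π) = avgReward r M π ∧
    ∃ c : ℝ, ∀ (n : ℕ) (s : St),
      |∑ t ∈ Finset.range n, expReward r M π t s - n * avgReward r M π s| ≤ c := by
  obtain ⟨u, w, hu, hr⟩ := exists_poisson r M π
  set Q := transMat M π with hQ
  have hpu : ∀ n : ℕ, (Q ^ n).mulVec u = u := by
    intro n
    induction n with
    | zero => simp
    | succ n ih => rw [pow_succ, ← Matrix.mulVec_mulVec, hu, ih]
  have hsum : ∀ (n : ℕ) (s : St), ∑ t ∈ Finset.range n, expReward r M π t s
      = n * u s + w s - (Q ^ n).mulVec w s := by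
    intro n s
    induction n with
    | zero => simp
    | succ n ih =>
      rw [Finset.sum_range_succ, ih]
      have : expReward r M π n s = u s + ((Q ^ n).mulVec w s - (Q ^ (n + 1)).mulVec w s) := by
        rw [expReward, hr, Matrix.mulVec_add, ← hQ, hpu, Matrix.mulVec_sub, Matrix.mulVec_mulVec,
          ← pow_succ]
        rfl
      rw [this]; push_cast; ring
  have hbd : ∀ (n : ℕ) (s : St),
      |∑ t ∈ Finset.range n, expReward r M π t s - n * u s| ≤ 2 * ∑ s, |w s| := by
    intro n s
    have hb : ∀ s, |w s| ≤ ∑ s, |w s| := fun s =>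
      Finset.single_le_sum (fun i _ => abs_nonneg (w i)) (Finset.mem_univ s)
    have hup := mulVec_le_of_le (transMat_pow_nonneg M π n) (transMat_pow_sum M π n)
      (fun s => (abs_le.1 (hb s)).2) s
    have hlo := le_mulVec_of_le (transMat_pow_nonneg M π n) (transMat_pow_sum M π n)
      (fun s => (abs_le.1 (hb s)).1) s
    have hws := abs_le.1 (hb s)
    rw [hsum]
    exact abs_le.2 ⟨by linarith, by linarith⟩
  have hav : avgReward r M π = u := funext fun s => avgReward_eq_of_bounded fun n => hbd n s
  rw [hav]
  exact ⟨hu, _, hbd⟩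

end Analysis

/-! ### Vanishing discount: the optimal average reward -/

section Optimality

variable {St Ac : Type*} [Fintype St] [Fintype Ac] [DecidableEq St] [DecidableEq Ac]

lemma transMat_det (M : Env St Ac) (f : St → Ac) (s s' : St) :
    transMat M (Policy.det f) s s' = M.prob s (f s) s' := by
  simp [transMat, Policy.prob, Policy.det, Pi.single_apply]

lemma rewardVec_det (r : St → Ac → ℝ) (f : St → Ac) (s : St) :
    rewardVec r (Policy.det f) s = r s (f s) := by
  simp [rewardVec, Policy.prob, Policy.det, Pi.single_apply]

lemma transMat_det_mulVec (M : Env St Ac) (f : St → Ac) (v : St → ℝ) (s : St) :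
    (transMat M (Policy.det f)).mulVec v s = ∑ s', M.prob s (f s) s' * v s' := by
  simp [Matrix.mulVec, dotProduct, transMat_det]

/-- A deterministic policy that maximizes the sum of the discounted values satisfies the Bellman
optimality inequality: otherwise changing it in one state would increase the sum. -/
lemma exists_det_bellman [Nonempty Ac] {β : ℝ} (h0 : 0 ≤ β) (h1 : β < 1) {r : St → Ac → ℝ}
    (hr : ∀ s a, r s a ∈ Set.Icc (0 : ℝ) 1) (M : Env St Ac) :
    ∃ f : St → Ac, ∀ s a, r s a + β * ∑ s', M.prob s a s' * discValue β r M (Policy.det f) s'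
      ≤ discValue β r M (Policy.det f) s := by
  obtain ⟨f, hf⟩ := Finite.exists_max fun f : St → Ac => ∑ s, discValue β r M (Policy.det f) s
  refine ⟨f, fun s₁ a₁ => ?_⟩
  by_contra! hlt
  set V := discValue β r M (Policy.det f) with hV
  set f' := Function.update f s₁ a₁ with hf'
  have hup : ∀ s, V s ≤ rewardVec r (Policy.det f') s
      + β * (transMat M (Policy.det f')).mulVec V s := by
    intro s
    rw [rewardVec_det, transMat_det_mulVec]
    by_cases hs : s = s₁
    · subst hs
      simpa [hf'] using hlt.le
    · rw [hf', Function.update_of_ne hs]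
      have := discValue_eq h0 h1 hr M (Policy.det f) s
      rw [rewardVec_det, transMat_det_mulVec] at this
      exact this.le
  have hle := le_discValue h0 h1 hr M (Policy.det f') hup
  have hstrict : V s₁ < discValue β r M (Policy.det f') s₁ := by
    rw [discValue_eq h0 h1 hr M (Policy.det f') s₁, rewardVec_det, transMat_det_mulVec]
    have hfs : f' s₁ = a₁ := by simp [hf']
    rw [hfs]
    refine hlt.trans_le ?_
    gcongr with s' _
    · exact M.prob_nonneg _ _ _
    · exact hle s'
  have := Finset.sum_lt_sum (fun s (_ : s ∈ Finset.univ) => hle s) ⟨s₁, Finset.mem_univ _, hstrict⟩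
  exact absurd (hf f') (not_le.2 this)

lemma discValue_le_of_bellman {β : ℝ} (h0 : 0 ≤ β) (h1 : β < 1) {r : St → Ac → ℝ}
    (hr : ∀ s a, r s a ∈ Set.Icc (0 : ℝ) 1) {M : Env St Ac} {v : St → ℝ}
    (hv : ∀ s a, r s a + β * ∑ s', M.prob s a s' * v s' ≤ v s) (π : Policy St Ac) (s : St) :
    discValue β r M π s ≤ v s := by
  refine discValue_le h0 h1 hr M π (fun s => ?_) s
  rw [transMat_mulVec, rewardVec, Finset.mul_sum, ← Finset.sum_add_distrib]
  calc ∑ a, (π.prob s a * r s a + β * (π.prob s a * ∑ s', M.prob s a s' * v s'))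
      = ∑ a, π.prob s a * (r s a + β * ∑ s', M.prob s a s' * v s') :=
        Finset.sum_congr rfl fun a _ => by ring
    _ ≤ ∑ a, π.prob s a * v s :=
        Finset.sum_le_sum fun a _ => mul_le_mul_of_nonneg_left (hv s a) (π.prob_nonneg s a)
    _ = v s := by rw [← Finset.sum_mul, π.sum_prob, one_mul]

/-- As the discount factor tends to `1`, the normalized discounted value tends to the average
reward. -/
lemma tendsto_discValue (r : St → Ac → ℝ) (M : Env St Ac) (π : Policy St Ac) {β : ℕ → ℝ}
    (h0 : ∀ n, 0 ≤ β n) (h1 : ∀ n, β n < 1) (hβ : Tendsto β atTop (nhds 1)) (s : St) :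
    Tendsto (fun n => (1 - β n) * discValue (β n) r M π s) atTop
      (nhds (avgReward r M π s)) := by
  obtain ⟨-, c, hc⟩ := avgReward_spec r M π
  have hz : Tendsto (fun n => (1 - β n) * c) atTop (nhds 0) := by
    simpa using ((tendsto_const_nhds (x := (1 : ℝ))).sub hβ).mul_const c
  rw [tendsto_iff_norm_sub_tendsto_zero]
  refine squeeze_zero (fun n => norm_nonneg _) (fun n => ?_) hz
  have hb : 0 < 1 - β n := sub_pos.2 (h1 n)
  have : (1 - β n) * discValue (β n) r M π s - avgReward r M π s
      = (1 - β n) * (discValue (β n) r M π s - avgReward r M π s / (1 - β n)) := by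
    field_simp
  rw [this, norm_mul, Real.norm_of_nonneg hb.le]
  exact mul_le_mul_of_nonneg_left (abs_discounted_sub_le (h0 n) (h1 n) fun n => hc n s) hb.le

/-- One deterministic policy is discount optimal for discount factors arbitrarily close to `1`.
Its average reward is maximal, and no action increases it in expectation. -/
lemma exists_avg_optimal [Nonempty Ac] {r : St → Ac → ℝ}
    (hr : ∀ s a, r s a ∈ Set.Icc (0 : ℝ) 1) (M : Env St Ac) :
    ∃ f : St → Ac, (∀ π s, avgReward r M π s ≤ avgReward r M (Policy.det f) s) ∧
      ∀ s a, ∑ s', M.prob s a s' * avgReward r M (Policy.det f) s'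
        ≤ avgReward r M (Policy.det f) s := by
  set β : ℕ → ℝ := fun n => 1 - 1 / ((n : ℝ) + 1) with hβdef
  have hpos : ∀ n : ℕ, (0 : ℝ) < 1 / ((n : ℝ) + 1) := fun n => Nat.one_div_pos_of_nat
  have h1 : ∀ n, β n < 1 := fun n => sub_lt_self _ (hpos n)
  have h0 : ∀ n, 0 ≤ β n := fun n => by
    simp only [hβdef, sub_nonneg]
    rw [div_le_one (by positivity)]
    linarith [n.cast_nonneg (α := ℝ)]
  have hβ : Tendsto β atTop (nhds 1) := by
    simpa [hβdef] using (tendsto_const_nhds (x := (1 : ℝ))).sub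
      (tendsto_one_div_add_atTop_nhds_zero_nat (𝕜 := ℝ))
  choose F hF using fun n => exists_det_bellman (h0 n) (h1 n) hr M
  obtain ⟨f, hf⟩ : ∃ f, ∃ᶠ n in atTop, F n = f := by
    by_contra! hcon
    have hall : ∀ᶠ n in atTop, ∀ f, F n ≠ f := by
      rw [eventually_all]
      intro f
      simpa [Filter.Frequently] using hcon f
    obtain ⟨n, hn⟩ := hall.exists
    exact hn _ rfl
  obtain ⟨φ, hφ, hFφ⟩ := extraction_of_frequently_atTop hf
  have hlim := fun π s => (tendsto_discValue r M π h0 h1 hβ s).comp hφ.tendsto_atTop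
  have hFn : ∀ n s a, r s a + β (φ n) * ∑ s', M.prob s a s' *
      discValue (β (φ n)) r M (Policy.det f) s' ≤ discValue (β (φ n)) r M (Policy.det f) s := by
    intro n s a
    have := hF (φ n) s a
    rwa [hFφ n] at this
  refine ⟨f, fun π s => ?_, fun s a => ?_⟩
  · refine le_of_tendsto_of_tendsto' (hlim π s) (hlim (Policy.det f) s) fun n => ?_
    exact mul_le_mul_of_nonneg_left
      (discValue_le_of_bellman (h0 _) (h1 _) hr (hFn n) π s) (sub_pos.2 (h1 _)).le
  · have hβφ := hβ.comp hφ.tendsto_atTop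
    have hl : Tendsto (fun n => β (φ n) * ∑ s', M.prob s a s' *
        ((1 - β (φ n)) * discValue (β (φ n)) r M (Policy.det f) s')) atTop
        (nhds (1 * ∑ s', M.prob s a s' * avgReward r M (Policy.det f) s')) :=
      hβφ.mul (tendsto_finsetSum _ fun s' _ => (hlim (Policy.det f) s').const_mul _)
    rw [one_mul] at hl
    refine le_of_tendsto_of_tendsto' hl (hlim (Policy.det f) s) fun n => ?_
    have hb : 0 < 1 - β (φ n) := sub_pos.2 (h1 _)
    have := mul_le_mul_of_nonneg_left (hFn n s a) hb.le
    have hrw : β (φ n) * ∑ s', M.prob s a s' *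
        ((1 - β (φ n)) * discValue (β (φ n)) r M (Policy.det f) s')
        = (1 - β (φ n)) * (β (φ n) * ∑ s', M.prob s a s' *
          discValue (β (φ n)) r M (Policy.det f) s') := by
      simp only [Finset.mul_sum]
      exact Finset.sum_congr rfl fun s' _ => by ring
    rw [hrw]
    refine le_trans ?_ this
    have := mul_nonneg hb.le (hr s a).1
    rw [mul_add]
    linarith

/-! ### Weakly communicating environments -/

/-- A nonempty closed set of a finite chain contains a state that is not transient. Among its
states choose one with the fewest reachable states: then all of these communicate with it, so
transience would make the transition probabilities to each of them vanish in the limit, although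
they sum to `1`. -/
lemma exists_not_transient (M : Env St Ac) (π : Policy St Ac) {D : Set St} (hne : D.Nonempty)
    (hD : ∀ s ∈ D, ∀ s' ∉ D, transMat M π s s' = 0) : ∃ s ∈ D, ¬ IsTransientState M π s := by
  classical
  by_contra! htr
  set Q := transMat M π with hQ
  have hDn : ∀ n, ∀ s ∈ D, ∀ s' ∉ D, (Q ^ n) s s' = 0 := by
    intro n
    induction n with
    | zero =>
      intro s hs s' hs'
      rw [pow_zero, Matrix.one_apply_ne]
      rintro rfl
      exact hs' hs
    | succ n ih =>
      intro s hs s' hs'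
      rw [pow_succ, Matrix.mul_apply]
      refine Finset.sum_eq_zero fun x _ => ?_
      by_cases hx : x ∈ D
      · rw [hD x hx s' hs', mul_zero]
      · rw [ih s hs x hx, zero_mul]
  let R : St → Finset St := fun s => Finset.univ.filter fun s' => ∃ n, 0 < (Q ^ n) s s'
  have hmul : ∀ m n x y z, (Q ^ m) x y * (Q ^ n) y z ≤ (Q ^ (m + n)) x z := by
    intro m n x y z
    rw [pow_add, Matrix.mul_apply]
    exact Finset.single_le_sum (f := fun y => (Q ^ m) x y * (Q ^ n) y z)
      (fun i _ => mul_nonneg (transMat_pow_nonneg M π m x i) (transMat_pow_nonneg M π n i z))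
      (Finset.mem_univ y)
  obtain ⟨s, hs, hmin⟩ := Set.exists_min_image D (fun s => (R s).card) D.toFinite hne
  have hRD : ∀ s' ∈ R s, s' ∈ D := by
    intro s' hs'
    obtain ⟨n, hn⟩ := (Finset.mem_filter.1 hs').2
    by_contra hcon
    exact hn.ne' (hDn n s hs s' hcon)
  have hself : ∀ x, x ∈ R x := fun x => by
    refine Finset.mem_filter.2 ⟨Finset.mem_univ _, 0, by simp⟩
  have hback : ∀ s' ∈ R s, s ∈ R s' := by
    intro s' hs'
    have hsub : R s' ⊆ R s := by
      intro x hx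
      obtain ⟨n, hn⟩ := (Finset.mem_filter.1 hs').2
      obtain ⟨k, hk⟩ := (Finset.mem_filter.1 hx).2
      exact Finset.mem_filter.2 ⟨Finset.mem_univ _, n + k, (mul_pos hn hk).trans_le (hmul _ _ _ _ _)⟩
    rw [Finset.eq_of_subset_of_card_le hsub (hmin s' (hRD s' hs'))]
    exact hself s
  have hlim : ∀ s' ∈ R s, Tendsto (fun n => (Q ^ n) s s') atTop (nhds 0) := by
    intro s' hs'
    obtain ⟨k, hk⟩ := (Finset.mem_filter.1 (hback s' hs')).2
    have hsum : Tendsto (fun n => (Q ^ n) s' s') atTop (nhds 0) :=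
      (htr s' (hRD s' hs')).tendsto_atTop_zero
    have h2 : Tendsto (fun n => ((Q ^ k) s' s)⁻¹ * (Q ^ (k + n)) s' s') atTop (nhds 0) := by
      have := (hsum.comp (tendsto_add_atTop_nat k)).const_mul ((Q ^ k) s' s)⁻¹
      simpa [Function.comp_def, add_comm] using this
    refine squeeze_zero (fun n => transMat_pow_nonneg M π n s s') (fun n => ?_) h2
    rw [le_inv_mul_iff₀ hk]
    exact hmul _ _ _ _ _
  have hone : ∀ n, ∑ s' ∈ R s, (Q ^ n) s s' = 1 := by
    intro n
    rw [← transMat_pow_sum M π n s]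
    refine Finset.sum_subset (Finset.subset_univ _) fun x _ hx => ?_
    by_contra hcon
    exact hx (Finset.mem_filter.2 ⟨Finset.mem_univ _, n,
      lt_of_le_of_ne (transMat_pow_nonneg M π n s x) (Ne.symm hcon)⟩)
  have h0 := tendsto_finsetSum (R s) hlim
  simp only [hone, Finset.sum_const_zero] at h0
  exact one_ne_zero (tendsto_nhds_unique tendsto_const_nhds h0)

/-- In a weakly communicating environment a function that no action increases in expectation,
and which some policy keeps invariant, is constant. -/
lemma IsWeaklyCommunicating.const_of_superharmonic [Nonempty St] {M : Env St Ac}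
    (hM : IsWeaklyCommunicating M) {g : St → ℝ}
    (hg : ∀ s a, ∑ s', M.prob s a s' * g s' ≤ g s) {π : Policy St Ac}
    (hπ : (transMat M π).mulVec g = g) : ∃ l : ℝ, ∀ s, g s = l := by
  obtain ⟨C, hC, hacc, htr⟩ := hM
  -- On `C`, a state of minimal value reaches every other state of `C`.
  have hconst : ∀ x ∈ C, ∀ y ∈ C, g x = g y := by
    intro x hx y hy
    have hne : C.Nonempty := ⟨x, hx⟩
    obtain ⟨m, hm, hmin⟩ := Set.exists_min_image C g C.toFinite hne
    suffices h : ∀ z ∈ C, g z = g m by rw [h x hx, h y hy]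
    intro z hz
    by_cases hmz : m = z
    · rw [hmz]
    obtain ⟨f, n, hn⟩ := hacc m hm z hz hmz
    set Q := transMat M (Policy.det f) with hQ
    have hQC : ∀ k, ∀ s ∈ C, ∀ s' ∉ C, (Q ^ k) s s' = 0 := by
      intro k
      induction k with
      | zero =>
        intro s hs s' hs'
        rw [pow_zero, Matrix.one_apply_ne]
        rintro rfl
        exact hs' hs
      | succ k ih =>
        intro s hs s' hs'
        rw [pow_succ, Matrix.mul_apply]
        refine Finset.sum_eq_zero fun w _ => ?_
        by_cases hw : w ∈ C
        · rw [hQ, transMat_det, hC w hw _ s' hs', mul_zero]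
        · rw [ih s hs w hw, zero_mul]
    have hQg : ∀ k s, (Q ^ k).mulVec g s ≤ g s := by
      intro k
      induction k with
      | zero => simp
      | succ k ih =>
        intro s
        rw [pow_succ, ← Matrix.mulVec_mulVec]
        refine le_trans (mulVec_mono_of_nonneg (transMat_pow_nonneg M _ k) (fun s' => ?_) s) (ih s)
        rw [hQ, transMat_det_mulVec]
        exact hg s' (f s')
    have hsum : ∑ s', (Q ^ n) m s' * (g s' - g m) ≤ 0 := by
      simp only [mul_sub, Finset.sum_sub_distrib]
      rw [← Finset.sum_mul, transMat_pow_sum, one_mul]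
      have := hQg n m
      simp only [Matrix.mulVec, dotProduct] at this
      linarith
    have hterm : ∀ s' ∈ Finset.univ, 0 ≤ (Q ^ n) m s' * (g s' - g m) := by
      intro s' _
      by_cases hs' : s' ∈ C
      · exact mul_nonneg (transMat_pow_nonneg M _ n m s') (sub_nonneg.2 (hmin s' hs'))
      · rw [hQC n m hm s' hs', zero_mul]
    have hz0 := (Finset.sum_eq_zero_iff_of_nonneg hterm).1
      (le_antisymm hsum (Finset.sum_nonneg hterm)) z (Finset.mem_univ z)
    rcases mul_eq_zero.1 hz0 with h | h
    · exact absurd h hn.ne'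
    · linarith
  -- The level sets of an extremal value are closed under `π`, hence meet `C`.
  have hlevel : ∀ e : St, ((∀ s, g s ≤ g e) ∨ ∀ s, g e ≤ g s) → ∃ s ∈ C, g s = g e := by
    intro e he
    obtain ⟨s, hs, hns⟩ := exists_not_transient M π (D := {s | g s = g e}) ⟨e, rfl⟩ (by
      intro s (hs : g s = g e) s' (hs' : g s' ≠ g e)
      have hinv : ∑ s', transMat M π s s' * (g s' - g e) = 0 := by
        simp only [mul_sub, Finset.sum_sub_distrib]
        rw [← Finset.sum_mul, transMat_sum, one_mul]
        have := congrFun hπ s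
        simp only [Matrix.mulVec, dotProduct] at this
        linarith
      have hzero : transMat M π s s' * (g s' - g e) = 0 := by
        rcases he with he | he
        · exact (Finset.sum_eq_zero_iff_of_nonpos fun x _ =>
            mul_nonpos_of_nonneg_of_nonpos (transMat_nonneg M π s x) (sub_nonpos.2 (he x))).1 hinv
            s' (Finset.mem_univ _)
        · exact (Finset.sum_eq_zero_iff_of_nonneg fun x _ =>
            mul_nonneg (transMat_nonneg M π s x) (sub_nonneg.2 (he x))).1 hinv
            s' (Finset.mem_univ _)
      exact (mul_eq_zero.1 hzero).resolve_right (sub_ne_zero.2 hs'))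
    refine ⟨s, ?_, hs⟩
    by_contra hsC
    exact hns (htr s hsC π)
  obtain ⟨e₁, h₁⟩ := Finite.exists_max g
  obtain ⟨e₂, h₂⟩ := Finite.exists_min g
  obtain ⟨s₁, hs₁, hg₁⟩ := hlevel e₁ (Or.inl h₁)
  obtain ⟨s₂, hs₂, hg₂⟩ := hlevel e₂ (Or.inr h₂)
  have : g e₁ = g e₂ := by rw [← hg₁, ← hg₂, hconst s₁ hs₁ s₂ hs₂]
  exact ⟨g e₁, fun s => le_antisymm (h₁ s) (this ▸ h₂ s)⟩

/-- In a weakly communicating environment the optimal discounted value varies by at most twice the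
reward averaging time of an optimal policy. -/
lemma exists_abs_optDiscValue_sub_le [Nonempty St] [Nonempty Ac] {γ : ℝ} (h0 : 0 ≤ γ) (h1 : γ < 1)
    {r : St → Ac → ℝ} (hr : ∀ s a, r s a ∈ Set.Icc (0 : ℝ) 1) {M : Env St Ac}
    (hM : IsWeaklyCommunicating M) {τ : ℝ≥0} (hτ : optRewardAvgTime γ r M ≤ (τ : ℝ≥0∞)) :
    ∃ k : ℝ, ∀ s, |optDiscValue γ r M s - k| ≤ τ := by
  obtain ⟨f, hf, hsup⟩ := exists_avg_optimal hr M
  set g := avgReward r M (Policy.det f) with hg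
  obtain ⟨l, hl⟩ := hM.const_of_superharmonic hsup (avgReward_spec r M (Policy.det f)).1
  refine ⟨l / (1 - γ), fun s => le_of_forall_pos_lt_add fun ε hε => ?_⟩
  lift ε to ℝ≥0 using hε.le
  have hlt : optRewardAvgTime γ r M < ((τ + ε : ℝ≥0) : ℝ≥0∞) :=
    hτ.trans_lt (by
      have : τ < τ + ε := lt_add_of_pos_right τ (by exact_mod_cast hε)
      exact_mod_cast this)
  simp only [optRewardAvgTime, rewardAvgTime, iInf_lt_iff] at hlt
  obtain ⟨π, ⟨hπd, hπa⟩, c, hc, hcτ⟩ := hlt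
  have havg : avgReward r M π s = l := by
    rw [hπa s, ← hl s]
    refine le_antisymm ?_ ?_
    · have : Nonempty (Policy St Ac) := ⟨π⟩
      exact ciSup_le fun π => hf π s
    · exact le_ciSup (f := fun π => avgReward r M π s) ⟨g s, by rintro _ ⟨π, rfl⟩; exact hf π s⟩
        (Policy.det f)
  rw [← hπd s, ← havg]
  refine (abs_discounted_sub_le h0 h1 fun n => hc n s).trans_lt ?_
  exact_mod_cast hcτ

end Optimality

/-! ### Values held during a pseudo-episode, and counting -/

/-- The value of `y` at the last time `u ≤ t` with `u = 0` or `x u = false`. With `x` the indicators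
`X` this is the value of `y` at the start of the pseudo-episode that contains step `t`. -/
def held {β : Type*} (x : ℕ → Bool) (y : ℕ → β) : ℕ → β
  | 0 => y 0
  | t + 1 => if x (t + 1) = true then held x y t else y (t + 1)

section Held

variable {β : Type*} {x : ℕ → Bool} {y : ℕ → β} {t : ℕ}

lemma held_of_false (h : x t = false) : held x y t = y t := by
  cases t with
  | zero => rfl
  | succ t => simp [held, h]

lemma held_succ_of_true (h : x (t + 1) = true) : held x y (t + 1) = held x y t := by
  simp [held, h]

lemma held_comp {β' : Type*} (f : β → β') (x : ℕ → Bool) (y : ℕ → β) (t : ℕ) :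
    held x (fun u => f (y u)) t = f (held x y t) := by
  induction t with
  | zero => rfl
  | succ t ih => simp only [held]; split_ifs <;> simp [ih]

/-- A sequence with increments at most `1` grows within a pseudo-episode at most by the age of the
pseudo-episode. -/
lemma le_held_add_age (x : ℕ → Bool) {N : ℕ → ℕ} (hN : ∀ t, N (t + 1) ≤ N t + 1) (t : ℕ) :
    N t + held x (fun u => u) t ≤ held x N t + t := by
  induction t with
  | zero => simp [held]
  | succ t ih =>
    simp only [held]
    have := hN t
    split_ifs <;> omega

end Held

/-- Within pseudo-episodes, a nondecreasing counter reaches four times its value at the start (or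
`4`, from the value `0`) at most `log m` times while the value at the start is below `m / 3`:
each time the counter grows by the factor `4`, and `exp (j + 1) ≤ 3 * 4 ^ j`. -/
lemma card_quadrupling_le_log (x : ℕ → Bool) {N : ℕ → ℕ} (hN : Monotone N) {m : ℝ} (hm : 1 ≤ m)
    (T : ℕ) :
    (((Finset.range T).filter fun t => x (t + 1) = true ∧ N t < 4 * max 1 (held x N t) ∧
      4 * max 1 (held x N t) ≤ N (t + 1) ∧ 3 * ((max 1 (held x N t) : ℕ) : ℝ) < m).card : ℝ)
      ≤ Real.log m := by
  classical
  set Q : ℕ → Prop := fun t => x (t + 1) = true ∧ N t < 4 * max 1 (held x N t) ∧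
      4 * max 1 (held x N t) ≤ N (t + 1) ∧ 3 * ((max 1 (held x N t) : ℕ) : ℝ) < m with hQ
  set c : ℕ → ℕ := fun t => ((Finset.range t).filter Q).card with hc
  -- The count of such times is at most the base-`4` logarithm of the counter, and of its value at
  -- the start as long as the current pseudo-episode has not contributed.
  have key : ∀ t, 4 ^ c t ≤ max 1 (N t) ∧
      (N t < 4 * max 1 (held x N t) → 4 ^ c t ≤ max 1 (held x N t)) ∧
      (c t : ℝ) ≤ Real.log m := by
    intro t
    induction t with
    | zero => simp [hc, Real.log_nonneg hm]
    | succ t ih =>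
      obtain ⟨ih1, ih2, ih3⟩ := ih
      have hmono := hN (Nat.le_succ t)
      by_cases hq : Q t
      · have hct : c (t + 1) = c t + 1 := by
          simp [hc, Finset.range_add_one, Finset.filter_insert, hq]
        obtain ⟨hx, hlt, hge, h3⟩ := hq
        have h4 := ih2 hlt
        rw [hct, held_succ_of_true hx]
        refine ⟨?_, fun h => absurd h (not_lt.2 hge), ?_⟩
        · rw [pow_succ]; omega
        · rw [Real.le_log_iff_exp_le (by linarith)]
          have e1 : Real.exp (((c t + 1 : ℕ) : ℝ)) ≤ 3 ^ (c t + 1) := by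
            rw [← Real.exp_one_pow]
            exact pow_le_pow_left₀ (Real.exp_pos 1).le (by linarith [Real.exp_one_lt_d9]) _
          have e2 : (3 : ℝ) ^ c t ≤ 4 ^ c t := pow_le_pow_left₀ (by norm_num) (by norm_num) _
          have e3 : (4 : ℝ) ^ c t ≤ ((max 1 (held x N t) : ℕ) : ℝ) := by exact_mod_cast h4
          rw [pow_succ] at e1
          linarith
      · have hct : c (t + 1) = c t := by
          simp [hc, Finset.range_add_one, Finset.filter_insert, hq]
        rw [hct]
        refine ⟨ih1.trans (max_le_max le_rfl hmono), fun h => ?_, ih3⟩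
        by_cases hx : x (t + 1) = true
        · rw [held_succ_of_true hx] at h ⊢
          exact ih2 (lt_of_le_of_lt hmono h)
        · rw [held_of_false (by simpa using hx)]
          exact ih1.trans (max_le_max le_rfl hmono)
  exact (key T).2.2

/-- Summing the inverse square roots of the visit counts along a sequence. -/
lemma sum_inv_sqrt_count_le {ι : Type*} [Fintype ι] [DecidableEq ι] (p : ℕ → ι) (T : ℕ) :
    ∑ t ∈ Finset.range T,
      1 / √((((Finset.range t).filter fun j => p j = p t).card : ℝ) + 1)
      ≤ 2 * √((Fintype.card ι : ℝ) * T) := by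
  set N : ℕ → ι → ℕ := fun t i => ((Finset.range t).filter fun j => p j = i).card with hN
  have hsucc : ∀ t i, N (t + 1) i = N t i + if p t = i then 1 else 0 := by
    intro t i
    simp only [hN, Finset.range_add_one, Finset.filter_insert]
    split_ifs <;> simp
  have h1 : ∀ T, ∑ t ∈ Finset.range T, 1 / √((N t (p t) : ℝ) + 1) ≤ 2 * ∑ i, √(N T i : ℝ) := by
    intro T
    induction T with
    | zero => simp [hN]
    | succ T ih =>
      rw [Finset.sum_range_succ]
      have hstep : 2 * ∑ i, √(N (T + 1) i : ℝ) = 2 * ∑ i, √(N T i : ℝ)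
          + 2 * (√((N T (p T) : ℝ) + 1) - √(N T (p T) : ℝ)) := by
        have : ∀ i, √(N (T + 1) i : ℝ) = √(N T i : ℝ) +
            if p T = i then √((N T i : ℝ) + 1) - √(N T i : ℝ) else 0 := by
          intro i
          rw [hsucc]
          split_ifs <;> simp
        simp only [this, Finset.sum_add_distrib, Finset.sum_ite_eq, Finset.mem_univ, if_true]
        ring
      rw [hstep]
      refine add_le_add ih ?_
      set n : ℝ := (N T (p T) : ℝ)
      have hn : 0 ≤ n := Nat.cast_nonneg _
      have hb : 0 < √(n + 1) := Real.sqrt_pos.2 (by linarith)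
      have hab : √n ≤ √(n + 1) := Real.sqrt_le_sqrt (by linarith)
      have ha2 := Real.sq_sqrt hn
      have hb2 := Real.sq_sqrt (show 0 ≤ n + 1 by linarith)
      rw [div_le_iff₀ hb]
      nlinarith [Real.sqrt_nonneg n, sq_nonneg (√(n + 1) - √n)]
  have h2 : ∑ i, (N T i : ℝ) = T := by
    have : ∑ i, N T i = T := by
      simpa [hN] using (Finset.card_eq_sum_card_fiberwise (f := p) (s := Finset.range T)
        (t := Finset.univ) (fun _ _ => Finset.mem_coe.2 (Finset.mem_univ _))).symm
    exact_mod_cast this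
  refine (h1 T).trans (mul_le_mul_of_nonneg_left (Real.le_sqrt_of_sq_le ?_) (by norm_num))
  refine (sq_sum_le_card_mul_sum_sq).trans_eq ?_
  simp only [Real.sq_sqrt (Nat.cast_nonneg _), h2, Finset.card_univ]

/-! ### Integrals against conditional probabilities -/

section CondProb

variable {Ω : Type*} {m m0 : MeasurableSpace Ω} {P : Measure Ω} [IsProbabilityMeasure P]

lemma integrable_of_abs_le {f : Ω → ℝ} (hf : Measurable f) {c : ℝ} (hc : ∀ ω, |f ω| ≤ c) :
    Integrable f P :=
  Integrable.of_bound hf.aestronglyMeasurable c (Eventually.of_forall hc)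

lemma integral_indicator_of_condProb (hm : m ≤ m0) {s : Set Ω} (hs : MeasurableSet s)
    {q f : Ω → ℝ} (hq : P⟦s | m⟧ =ᵐ[P] q) (hf : Measurable[m] f) (hfi : Integrable f P) :
    Integrable (fun ω => q ω * f ω) P ∧ ∫ ω, s.indicator f ω ∂P = ∫ ω, q ω * f ω ∂P := by
  have h1 : (s.indicator fun _ => (1 : ℝ)) * f = s.indicator f := by
    funext ω; by_cases h : ω ∈ s <;> simp [h]
  have hint : Integrable (s.indicator f) P := hfi.indicator hs
  have hc := condExp_mul_of_stronglyMeasurable_right (μ := P) (m := m)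
    (f := s.indicator fun _ => (1 : ℝ)) (g := f) hf.stronglyMeasurable (h1 ▸ hint)
    ((integrable_const _).indicator hs)
  rw [h1] at hc
  have he : P[s.indicator f | m] =ᵐ[P] fun ω => q ω * f ω := by
    filter_upwards [hc, hq] with ω h2 h3
    rw [h2, Pi.mul_apply, h3]
  exact ⟨integrable_condExp.congr he, by rw [← integral_condExp hm, integral_congr_ae he]⟩

/-- Averaging a random variable with finitely many values given the past. -/
lemma integral_eval_of_condProb {α : Type*} [Fintype α] [MeasurableSpace α]
    [MeasurableSingletonClass α] (hm : m ≤ m0) {Y : Ω → α} (hY : Measurable Y)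
    {q : α → Ω → ℝ} (hq : ∀ a, P⟦Y ⁻¹' {a} | m⟧ =ᵐ[P] q a) {f : α → Ω → ℝ}
    (hf : ∀ a, Measurable[m] (f a)) {c : ℝ} (hc : ∀ a ω, |f a ω| ≤ c) :
    ∫ ω, f (Y ω) ω ∂P = ∫ ω, ∑ a, q a ω * f a ω ∂P := by
  classical
  have hfi : ∀ a, Integrable (f a) P := fun a =>
    integrable_of_abs_le ((hf a).mono hm le_rfl) (hc a)
  have hs : ∀ a, MeasurableSet (Y ⁻¹' {a}) := fun a => hY (measurableSet_singleton a)
  have h := fun a => integral_indicator_of_condProb hm (hs a) (hq a) (hf a) (hfi a)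
  have he : ∀ ω, f (Y ω) ω = ∑ a, (Y ⁻¹' {a}).indicator (f a) ω := by
    intro ω
    rw [Finset.sum_eq_single (Y ω)]
    · simp
    · intro b _ hb
      exact Set.indicator_of_notMem (fun hmem => hb hmem.symm) _
    · simp
  simp only [he]
  rw [integral_finsetSum _ fun a _ => (hfi a).indicator (hs a),
    integral_finsetSum _ fun a _ => (h a).1]
  exact Finset.sum_congr rfl fun a _ => (h a).2

end CondProb

/-! ### Measurability of histories -/

/-- The numbers of transitions `(s, a, s')` among the first `t` steps. -/
def transCount {St Ac : Type*} [DecidableEq St] [DecidableEq Ac] (σ : ℕ → St) (α : ℕ → Ac)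
    (t : ℕ) : St → Ac → St → ℕ :=
  fun s a s' => ((Finset.range t).filter fun i => σ i = s ∧ α i = a ∧ σ (i + 1) = s').card

/-- The number of visits to the pair `(s, a)` recorded in a table of transition counts. -/
def visits {St Ac : Type*} [Fintype St] (d : St → Ac → St → ℕ) (s : St) (a : Ac) : ℕ :=
  ∑ s', d s a s'

lemma transCount_succ {St Ac : Type*} [DecidableEq St] [DecidableEq Ac] (σ : ℕ → St) (α : ℕ → Ac)
    (t : ℕ) (s : St) (a : Ac) (s' : St) : transCount σ α (t + 1) s a s' =
      transCount σ α t s a s' + if σ t = s ∧ α t = a ∧ σ (t + 1) = s' then 1 else 0 := by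
  simp only [transCount, Finset.range_add_one, Finset.filter_insert]
  split_ifs <;> simp

lemma visits_transCount {St Ac : Type*} [Fintype St] [DecidableEq St] [DecidableEq Ac]
    (σ : ℕ → St) (α : ℕ → Ac) (t : ℕ) (s : St) (a : Ac) : visits (transCount σ α t) s a =
      ((Finset.range t).filter fun j => (σ j, α j) = (s, a)).card := by
  rw [Finset.card_eq_sum_card_fiberwise (f := fun j => σ (j + 1)) (t := Finset.univ)
    (fun _ _ => Finset.mem_coe.2 (Finset.mem_univ _))]
  simp only [visits, transCount, Finset.filter_filter, Prod.mk.injEq, and_assoc]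

lemma visits_transCount_succ {St Ac : Type*} [Fintype St] [DecidableEq St] [DecidableEq Ac]
    (σ : ℕ → St) (α : ℕ → Ac) (t : ℕ) (s : St) (a : Ac) :
    visits (transCount σ α (t + 1)) s a =
      visits (transCount σ α t) s a + if σ t = s ∧ α t = a then 1 else 0 := by
  simp only [visits_transCount, Finset.range_add_one, Finset.filter_insert, Prod.mk.injEq]
  split_ifs <;> simp

section History

variable {Ω St Ac : Type*} [Fintype St] [DecidableEq St] [MeasurableSpace St]
  [MeasurableSingletonClass St] [Fintype Ac] [DecidableEq Ac] [MeasurableSpace Ac]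
  [MeasurableSingletonClass Ac]
  (E : Ω → Env St Ac) (samp : ℕ → Ω → Env St Ac) (X : ℕ → Ω → Bool)
  (S : ℕ → Ω → St) (A : ℕ → Ω → Ac)

lemma pastSigma_le_preAction (t : ℕ) :
    pastSigma E samp X S A t ≤ preActionSigma E samp X S A t := le_sup_left

lemma preAction_le_preTransition (t : ℕ) :
    preActionSigma E samp X S A t ≤ preTransitionSigma E samp X S A t := le_sup_left

lemma preTransition_le_preCoin (t : ℕ) :
    preTransitionSigma E samp X S A t ≤ preCoinSigma E samp X S A t := le_sup_left

lemma preCoin_le_pastSigma_succ (t : ℕ) :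
    preCoinSigma E samp X S A t ≤ pastSigma E samp X S A (t + 1) := le_sup_left

lemma pastSigma_mono : Monotone (pastSigma E samp X S A) :=
  monotone_nat_of_le_succ fun t => (pastSigma_le_preAction E samp X S A t).trans
    ((preAction_le_preTransition E samp X S A t).trans
      ((preTransition_le_preCoin E samp X S A t).trans (preCoin_le_pastSigma_succ E samp X S A t)))

lemma measurable_samp_preAction (t : ℕ) :
    Measurable[preActionSigma E samp X S A t] (samp t) :=
  (comap_measurable (samp t)).mono le_sup_right le_rfl

lemma measurable_action_preTransition (t : ℕ) :
    Measurable[preTransitionSigma E samp X S A t] (A t) :=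
  (comap_measurable (A t)).mono le_sup_right le_rfl

lemma measurable_state_preCoin (t : ℕ) :
    Measurable[preCoinSigma E samp X S A t] (S (t + 1)) :=
  (comap_measurable (S (t + 1))).mono le_sup_right le_rfl

lemma comap_env_sup_histSigma_le (t : ℕ) :
    MeasurableSpace.comap E inferInstance ⊔ histSigma S A t ≤ pastSigma E samp X S A t := by
  induction t with
  | zero => exact sup_le (le_sup_left.trans le_sup_left) (le_sup_right.trans le_sup_left)
  | succ t ih =>
    have h1 := preTransition_le_preCoin E samp X S A t
    have h2 := preCoin_le_pastSigma_succ E samp X S A t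
    have h0 := pastSigma_mono E samp X S A (Nat.le_succ t)
    refine sup_le (le_sup_left.trans (ih.trans h0)) (sup_le (sup_le ?_ ?_) ?_)
    · exact le_sup_right.trans (ih.trans h0)
    · exact le_sup_right.trans (h1.trans h2)
    · exact le_sup_right.trans h2

lemma comap_env_sup_histSigma_succ_le (t : ℕ) :
    MeasurableSpace.comap E inferInstance ⊔ histSigma S A (t + 1)
      ≤ preCoinSigma E samp X S A t := by
  have h0 : pastSigma E samp X S A t ≤ preCoinSigma E samp X S A t :=
    (pastSigma_le_preAction E samp X S A t).trans
      ((preAction_le_preTransition E samp X S A t).trans (preTransition_le_preCoin E samp X S A t))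
  have ih := comap_env_sup_histSigma_le E samp X S A t
  refine sup_le (le_sup_left.trans (ih.trans h0)) (sup_le (sup_le ?_ ?_) ?_)
  · exact le_sup_right.trans (ih.trans h0)
  · exact le_sup_right.trans (preTransition_le_preCoin E samp X S A t)
  · exact le_sup_right

lemma measurable_env_past (t : ℕ) : Measurable[pastSigma E samp X S A t] E :=
  (comap_measurable E).mono (le_sup_left.trans (comap_env_sup_histSigma_le E samp X S A t)) le_rfl

lemma measurable_coin_past (t : ℕ) : Measurable[pastSigma E samp X S A t] (X t) := by
  cases t with
  | zero => exact (comap_measurable (X 0)).mono le_sup_right le_rfl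
  | succ t => exact (comap_measurable (X (t + 1))).mono le_sup_right le_rfl

lemma histSigma_mono : Monotone (histSigma S A) :=
  monotone_nat_of_le_succ fun _ => le_sup_left.trans le_sup_left

lemma measurable_state_hist (t : ℕ) : Measurable[histSigma S A t] (S t) := by
  cases t with
  | zero => exact (comap_measurable (S 0))
  | succ t => exact (comap_measurable (S (t + 1))).mono le_sup_right le_rfl

lemma measurable_action_hist (t : ℕ) : Measurable[histSigma S A (t + 1)] (A t) :=
  (comap_measurable (A t)).mono (le_sup_right.trans le_sup_left) le_rfl

lemma measurable_transCount (t : ℕ) :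
    Measurable[histSigma S A t] fun ω => transCount (fun i => S i ω) (fun i => A i ω) t := by
  induction t with
  | zero =>
    have : (fun ω => transCount (fun i => S i ω) (fun i => A i ω) 0) = fun _ => 0 := by
      funext ω s a s'; simp [transCount]
    rw [this]
    exact measurable_const
  | succ t ih =>
    have hle := histSigma_mono S A (Nat.le_succ t)
    have h1 := (measurable_state_hist S A t).mono hle le_rfl
    have h2 := measurable_action_hist S A t
    have h3 := measurable_state_hist S A (t + 1)
    have ih' := ih.mono hle le_rfl
    have hstep : (fun ω => transCount (fun i => S i ω) (fun i => A i ω) (t + 1)) =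
        (fun p : (St → Ac → St → ℕ) × St × Ac × St => fun s a s' => p.1 s a s' +
          if p.2.1 = s ∧ p.2.2.1 = a ∧ p.2.2.2 = s' then 1 else 0) ∘
        fun ω => (transCount (fun i => S i ω) (fun i => A i ω) t, S t ω, A t ω, S (t + 1) ω) := by
      funext ω s a s'
      simp [transCount_succ]
    rw [hstep]
    exact (measurable_of_countable _).comp (ih'.prodMk (h1.prodMk (h2.prodMk h3)))

lemma histSigma_le_past (t : ℕ) : histSigma S A t ≤ pastSigma E samp X S A t :=
  le_sup_right.trans (comap_env_sup_histSigma_le E samp X S A t)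

lemma measurable_held {β : Type*} [MeasurableSpace β] {Y : ℕ → Ω → β} (t : ℕ)
    (hY : ∀ u ≤ t, Measurable[pastSigma E samp X S A t] (Y u)) :
    Measurable[pastSigma E samp X S A t]
      fun ω => held (fun u => X u ω) (fun u => Y u ω) t := by
  suffices h : ∀ u ≤ t, Measurable[pastSigma E samp X S A t]
      fun ω => held (fun u => X u ω) (fun u => Y u ω) u from h t le_rfl
  intro u
  induction u with
  | zero => exact fun _ => hY 0 (Nat.zero_le t)
  | succ u ih =>
    intro hu
    have hX := (measurable_coin_past E samp X S A (u + 1)).mono (pastSigma_mono E samp X S A hu)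
      le_rfl
    exact Measurable.ite (hX (measurableSet_singleton true)) (ih (by omega)) (hY _ hu)

end History

/-! ### The laws of a run -/

section Laws

variable {Ω St Ac : Type*} [Fintype St] [DecidableEq St] [MeasurableSpace St]
  [MeasurableSingletonClass St] [Fintype Ac] [DecidableEq Ac] [MeasurableSpace Ac]
  [MeasurableSingletonClass Ac] [mΩ : MeasurableSpace Ω]
  {P : Measure Ω} [IsProbabilityMeasure P] {γ : ℝ} {prior : Measure (Env St Ac)} {s₀ : St}
  {planner : Env St Ac → Policy St Ac}
  {E : Ω → Env St Ac} {samp : ℕ → Ω → Env St Ac} {X : ℕ → Ω → Bool}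
  {S : ℕ → Ω → St} {A : ℕ → Ω → Ac}
  (hrun : IsRun P γ prior s₀ planner E samp X S A)
include hrun

namespace IsRun

lemma pastSigma_le (t : ℕ) : pastSigma E samp X S A t ≤ mΩ := by
  induction t with
  | zero =>
    exact sup_le (sup_le hrun.measurable_env.comap_le (hrun.measurable_state 0).comap_le)
      (hrun.measurable_coin 0).comap_le
  | succ t ih =>
    exact sup_le (sup_le (sup_le (sup_le ih (hrun.measurable_samp t).comap_le)
      (hrun.measurable_action t).comap_le) (hrun.measurable_state _).comap_le)
      (hrun.measurable_coin _).comap_le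

lemma preCoinSigma_le (t : ℕ) : preCoinSigma E samp X S A t ≤ mΩ :=
  (preCoin_le_pastSigma_succ E samp X S A t).trans (hrun.pastSigma_le (t + 1))

lemma preTransitionSigma_le (t : ℕ) : preTransitionSigma E samp X S A t ≤ mΩ :=
  (preTransition_le_preCoin E samp X S A t).trans (hrun.preCoinSigma_le t)

lemma preActionSigma_le (t : ℕ) : preActionSigma E samp X S A t ≤ mΩ :=
  (preAction_le_preTransition E samp X S A t).trans (hrun.preTransitionSigma_le t)

lemma integral_action (t : ℕ) {f : Ac → Ω → ℝ}
    (hf : ∀ a, Measurable[preActionSigma E samp X S A t] (f a)) {c : ℝ}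
    (hc : ∀ a ω, |f a ω| ≤ c) : ∫ ω, f (A t ω) ω ∂P =
      ∫ ω, ∑ a, (planner (samp t ω)).prob (S t ω) a * f a ω ∂P :=
  integral_eval_of_condProb (hrun.preActionSigma_le t) (hrun.measurable_action t)
    (hrun.action_law t) hf hc

lemma integral_transition (t : ℕ) {f : St → Ω → ℝ}
    (hf : ∀ s, Measurable[preTransitionSigma E samp X S A t] (f s)) {c : ℝ}
    (hc : ∀ s ω, |f s ω| ≤ c) : ∫ ω, f (S (t + 1) ω) ω ∂P =
      ∫ ω, ∑ s', (E ω).prob (S t ω) (A t ω) s' * f s' ω ∂P :=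
  integral_eval_of_condProb (hrun.preTransitionSigma_le t) (hrun.measurable_state (t + 1))
    (hrun.state_law t) hf hc

lemma integral_continue (t : ℕ) {f : Ω → ℝ} (hf : Measurable[preCoinSigma E samp X S A t] f)
    (hfi : Integrable f P) :
    ∫ ω in X (t + 1) ⁻¹' {true}, f ω ∂P = γ * ∫ ω, f ω ∂P := by
  have hs : MeasurableSet (X (t + 1) ⁻¹' {true}) :=
    hrun.measurable_coin (t + 1) (measurableSet_singleton true)
  rw [← integral_indicator hs, ← integral_const_mul]
  exact (integral_indicator_of_condProb (hrun.preCoinSigma_le t) hs (hrun.coin_law t) hf hfi).2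

end IsRun

/-- The probability that a pseudo-episode starts at step `t`. -/
def startProb (γ : ℝ) : ℕ → ℝ
  | 0 => 1
  | _ + 1 => 1 - γ

namespace IsRun

/-- The start of a pseudo-episode is independent of the true environment and the history. -/
lemma integral_start (t : ℕ) {f : Ω → ℝ}
    (hf : Measurable[MeasurableSpace.comap E inferInstance ⊔ histSigma S A t] f)
    (hfi : Integrable f P) :
    ∫ ω in X t ⁻¹' {false}, f ω ∂P = startProb γ t * ∫ ω, f ω ∂P := by
  have hs : MeasurableSet (X t ⁻¹' {false}) :=
    hrun.measurable_coin t (measurableSet_singleton false)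
  cases t with
  | zero =>
    rw [startProb, one_mul, Measure.restrict_eq_self_of_ae_mem]
    exact hrun.init_coin
  | succ t =>
    have hc : X (t + 1) ⁻¹' {false} = (X (t + 1) ⁻¹' {true})ᶜ := by
      ext ω; simp
    have hst : MeasurableSet (X (t + 1) ⁻¹' {true}) :=
      hrun.measurable_coin _ (measurableSet_singleton true)
    have h := integral_add_compl hst hfi
    rw [hrun.integral_continue t
      (hf.mono (comap_env_sup_histSigma_succ_le E samp X S A t) le_rfl) hfi] at h
    rw [hc, startProb]
    linarith

/-- At the start of a pseudo-episode, the sampled and the true environment have the same joint law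
with the history. -/
lemma map_samp_eq_map_env (t : ℕ) {H : Type*} [MeasurableSpace H] {Y : Ω → H}
    (hY : Measurable[histSigma S A t] Y) :
    (P.restrict (X t ⁻¹' {false})).map (fun ω => (samp t ω, Y ω)) =
      (P.restrict (X t ⁻¹' {false})).map (fun ω => (E ω, Y ω)) := by
  have hle := hrun.pastSigma_le t
  have hhist : histSigma S A t ≤ mΩ := (histSigma_le_past E samp X S A t).trans hle
  have hYm : Measurable Y := hY.mono hhist le_rfl
  have hs : MeasurableSet (X t ⁻¹' {false}) :=
    hrun.measurable_coin t (measurableSet_singleton false)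
  refine Measure.ext_prod fun {B G} hB hG => ?_
  rw [Measure.map_apply ((hrun.measurable_samp t).prodMk hYm) (hB.prod hG),
    Measure.map_apply (hrun.measurable_env.prodMk hYm) (hB.prod hG)]
  have hBs : MeasurableSet (samp t ⁻¹' B) := hrun.measurable_samp t hB
  have hBe : MeasurableSet (E ⁻¹' B) := hrun.measurable_env hB
  have hGh : MeasurableSet[histSigma S A t] (Y ⁻¹' G) := hY hG
  have hGp : MeasurableSet[pastSigma E samp X S A t] (X t ⁻¹' {false} ∩ Y ⁻¹' G) :=
    MeasurableSet.inter (measurable_coin_past E samp X S A t (measurableSet_singleton false))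
      (histSigma_le_past E samp X S A t _ hGh)
  have hsub : histSigma S A t ≤ MeasurableSpace.comap E inferInstance ⊔ histSigma S A t :=
    le_sup_right
  have hone : ∀ (s : Set Ω), MeasurableSet s → Integrable (s.indicator fun _ => (1 : ℝ)) P :=
    fun s hs => (integrable_const _).indicator hs
  have hreal : ∀ s : Set Ω, MeasurableSet s →
      (P.restrict (X t ⁻¹' {false})).real (s ∩ Y ⁻¹' G)
        = ∫ ω in X t ⁻¹' {false} ∩ Y ⁻¹' G, s.indicator (fun _ => (1 : ℝ)) ω ∂P := by
    intro s hsm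
    rw [measureReal_restrict_apply (hsm.inter (hhist _ hGh)), setIntegral_indicator hsm,
      setIntegral_const, smul_eq_mul, mul_one]
    congr 1
    ext ω
    simp only [Set.mem_inter_iff]
    tauto
  have e1 : ∫ ω in X t ⁻¹' {false} ∩ Y ⁻¹' G, (samp t ⁻¹' B).indicator (fun _ => (1 : ℝ)) ω ∂P
      = ∫ ω in X t ⁻¹' {false} ∩ Y ⁻¹' G, (E ⁻¹' B).indicator (fun _ => (1 : ℝ)) ω ∂P := by
    rw [← setIntegral_condExp hle (hone _ hBs) hGp]
    have hae : ∀ᵐ ω ∂P.restrict (X t ⁻¹' {false} ∩ Y ⁻¹' G),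
        (P⟦samp t ⁻¹' B | pastSigma E samp X S A t⟧) ω = (P⟦E ⁻¹' B | histSigma S A t⟧) ω := by
      rw [ae_restrict_iff' (hle _ hGp)]
      filter_upwards [hrun.samp_law t B hB] with ω h1 h2
      exact h1 h2.1
    rw [integral_congr_ae hae]
    have hmove : ∀ f : Ω → ℝ, Integrable f P →
        Measurable[MeasurableSpace.comap E inferInstance ⊔ histSigma S A t] f →
        ∫ ω in X t ⁻¹' {false} ∩ Y ⁻¹' G, f ω ∂P = startProb γ t * ∫ ω in Y ⁻¹' G, f ω ∂P := by
      intro f hfi hfm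
      rw [← setIntegral_indicator (hhist _ hGh), ← integral_indicator (hhist _ hGh)]
      exact hrun.integral_start t (hfm.indicator (hsub _ hGh)) (hfi.indicator (hhist _ hGh))
    rw [hmove _ integrable_condExp
        (stronglyMeasurable_condExp.measurable.mono hsub le_rfl),
      hmove _ (hone _ hBe), setIntegral_condExp hhist (hone _ hBe) hGh]
    exact Measurable.indicator measurable_const
      ((comap_measurable E).mono le_sup_left le_rfl hB)
  have := (hreal _ hBs).trans (e1.trans (hreal _ hBe).symm)
  exact (measureReal_eq_measureReal_iff).1 this

end IsRun

end Laws

/-! ### Concentration of the transition counts -/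

/-- Hoeffding's lemma for a variable with values in `[-1, 1]` on a finite probability space. -/
lemma sum_mul_exp_le {St : Type*} [Fintype St] {p : St → ℝ} (hp0 : ∀ s, 0 ≤ p s)
    (hp1 : ∑ s, p s = 1) {σ : St → ℝ} (hσ : ∀ s, |σ s| ≤ 1) (l : ℝ) :
    ∑ s, p s * Real.exp (l * (σ s - ∑ s, p s * σ s)) ≤ Real.exp (l ^ 2 / 2) := by
  let _ : MeasurableSpace St := ⊤
  set μ : Measure St := ∑ s, ENNReal.ofReal (p s) • Measure.dirac s with hμ
  have hint : ∀ f : St → ℝ, ∫ s, f s ∂μ = ∑ s, p s * f s := by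
    intro f
    rw [hμ, integral_finsetSum_measure]
    · refine Finset.sum_congr rfl fun s _ => ?_
      rw [integral_smul_measure, integral_dirac, ENNReal.toReal_ofReal (hp0 s), smul_eq_mul]
    · intro s _
      exact (integrable_dirac (by simp)).smul_measure ENNReal.ofReal_ne_top
  have : IsProbabilityMeasure μ := ⟨by
    rw [hμ]
    simp only [Measure.coe_finsetSum, Finset.sum_apply, Measure.smul_apply, measure_univ,
      smul_eq_mul, mul_one]
    rw [← ENNReal.ofReal_sum_of_nonneg fun s _ => hp0 s, hp1, ENNReal.ofReal_one]⟩
  have h := (hasSubgaussianMGF_of_mem_Icc (μ := μ) (X := σ) (a := -1) (b := 1)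
    (measurable_from_top.aemeasurable)
    (Eventually.of_forall fun s => ⟨(abs_le.1 (hσ s)).1, (abs_le.1 (hσ s)).2⟩)).mgf_le l
  rw [mgf, hint, hint] at h
  refine h.trans_eq ?_
  congr 1
  have : ‖(1 : ℝ) - -1‖₊ = 2 := by
    ext; norm_num
  rw [this]
  norm_num

section Confidence

variable {St Ac : Type*} [Fintype St] [Fintype Ac]

/-- The confidence set of a table of transition counts: the environments for which all transition
probabilities from visited pairs are close in `ℓ¹` to the empirical ones. Multiplied by the number
of visits, the condition is void for the pairs that have not been visited. -/
def confSet (c : ℝ) (d : St → Ac → St → ℕ) : Set (Env St Ac) :=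
  {M | ∀ s a, ∑ s', |(visits d s a : ℝ) * M.prob s a s' - d s a s'| ≤ c * √(visits d s a : ℝ)}

lemma measurable_prob (s : St) (a : Ac) (s' : St) :
    Measurable fun M : Env St Ac => M.prob s a s' :=
  (measurable_pi_apply s').comp (measurable_subtype_coe.comp
    ((measurable_pi_apply a).comp (measurable_pi_apply s)))

lemma measurableSet_confSet (c : ℝ) :
    MeasurableSet {p : Env St Ac × (St → Ac → St → ℕ) | p.1 ∈ confSet c p.2} := by
  have h : {p : Env St Ac × (St → Ac → St → ℕ) | p.1 ∈ confSet c p.2} = ⋂ s, ⋂ a,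
      {p | ∑ s', |(visits p.2 s a : ℝ) * p.1.prob s a s' - p.2 s a s'|
        ≤ c * √(visits p.2 s a : ℝ)} := by
    ext p; simp [confSet]
  rw [h]
  refine MeasurableSet.iInter fun s => MeasurableSet.iInter fun a => measurableSet_le ?_ ?_
  · refine Finset.measurable_sum _ fun s' _ => ?_
    have h1 : Measurable fun p : Env St Ac × (St → Ac → St → ℕ) => (visits p.2 s a : ℝ) :=
      (measurable_of_countable fun d => (visits d s a : ℝ)).comp measurable_snd
    have h2 : Measurable fun p : Env St Ac × (St → Ac → St → ℕ) => (p.2 s a s' : ℝ) :=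
      (measurable_of_countable fun d : St → Ac → St → ℕ => (d s a s' : ℝ)).comp measurable_snd
    exact ((h1.mul ((measurable_prob s a s').comp measurable_fst)).sub h2).abs
  · exact (measurable_of_countable fun d => c * √(visits d s a : ℝ)).comp measurable_snd

lemma sum_abs_prob_sub_le_two (M M' : Env St Ac) (s : St) (a : Ac) :
    ∑ s', |M.prob s a s' - M'.prob s a s'| ≤ 2 := by
  calc ∑ s', |M.prob s a s' - M'.prob s a s'|
      ≤ ∑ s', (M.prob s a s' + M'.prob s a s') := Finset.sum_le_sum fun s' _ => by
        have h1 := M.prob_nonneg s a s'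
        have h2 := M'.prob_nonneg s a s'
        exact abs_le.2 ⟨by linarith, by linarith⟩
    _ = 2 := by rw [Finset.sum_add_distrib, M.sum_prob, M'.sum_prob]; norm_num

/-- Two environments in a confidence set are `ℓ¹`-close. -/
lemma sum_abs_prob_sub_le {c : ℝ} (hc : 1 ≤ c) {d : St → Ac → St → ℕ} {M M' : Env St Ac}
    (hM : M ∈ confSet c d) (hM' : M' ∈ confSet c d) (s : St) (a : Ac) :
    ∑ s', |M.prob s a s' - M'.prob s a s'| ≤ 2 * c / √((max 1 (visits d s a) : ℕ) : ℝ) := by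
  rcases Nat.eq_zero_or_pos (visits d s a) with h | h
  · rw [h, max_eq_left (Nat.zero_le 1), Nat.cast_one, Real.sqrt_one, div_one]
    exact (sum_abs_prob_sub_le_two M M' s a).trans (by linarith)
  · rw [max_eq_right h]
    have hn : (0 : ℝ) < visits d s a := by exact_mod_cast h
    have hsq : (0 : ℝ) < √(visits d s a : ℝ) := Real.sqrt_pos.2 hn
    have h2 : (visits d s a : ℝ) * ∑ s', |M.prob s a s' - M'.prob s a s'|
        ≤ 2 * c * √(visits d s a : ℝ) := by
      calc (visits d s a : ℝ) * ∑ s', |M.prob s a s' - M'.prob s a s'|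
          = ∑ s', |((visits d s a : ℝ) * M.prob s a s' - d s a s')
              - ((visits d s a : ℝ) * M'.prob s a s' - d s a s')| := by
            rw [Finset.mul_sum]
            refine Finset.sum_congr rfl fun s' _ => ?_
            rw [← abs_of_pos hn, ← abs_mul, abs_of_pos hn]
            congr 1; ring
        _ ≤ ∑ s', (|(visits d s a : ℝ) * M.prob s a s' - d s a s'|
              + |(visits d s a : ℝ) * M'.prob s a s' - d s a s'|) :=
            Finset.sum_le_sum fun s' _ => abs_sub _ _
        _ ≤ 2 * c * √(visits d s a : ℝ) := by
            rw [Finset.sum_add_distrib]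
            linarith [hM s a, hM' s a]
    rw [le_div_iff₀ hsq]
    have h3 := Real.mul_self_sqrt hn.le
    refine le_of_mul_le_mul_right ?_ hsq
    calc _ = (visits d s a : ℝ) * ∑ s', |M.prob s a s' - M'.prob s a s'| := by
            rw [mul_assoc, h3, mul_comm]
      _ ≤ _ := h2

/-- The exponential of the deviation, in direction `σ`, of the transition counts from the pair
`(s, a)` from their conditional expectations, normalized so as to be a supermartingale. -/
def expDev (l : ℝ) (σ : St → ℝ) (s : St) (a : Ac) (M : Env St Ac) (d : St → Ac → St → ℕ) : ℝ :=
  Real.exp (l * ∑ s', σ s' * ((d s a s' : ℝ) - visits d s a * M.prob s a s')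
    - l ^ 2 / 2 * visits d s a)

lemma measurable_expDev (l : ℝ) (σ : St → ℝ) (s : St) (a : Ac) :
    Measurable fun p : Env St Ac × (St → Ac → St → ℕ) => expDev l σ s a p.1 p.2 := by
  have h1 : Measurable fun p : Env St Ac × (St → Ac → St → ℕ) => (visits p.2 s a : ℝ) :=
    (measurable_of_countable fun d => (visits d s a : ℝ)).comp measurable_snd
  have h2 : ∀ s', Measurable fun p : Env St Ac × (St → Ac → St → ℕ) => (p.2 s a s' : ℝ) :=
    fun s' => (measurable_of_countable fun d : St → Ac → St → ℕ => (d s a s' : ℝ)).comp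
      measurable_snd
  have h3 : ∀ s', Measurable fun p : Env St Ac × (St → Ac → St → ℕ) => p.1.prob s a s' :=
    fun s' => (measurable_prob s a s').comp measurable_fst
  exact Real.measurable_exp.comp (((Finset.measurable_sum _ fun s' _ =>
    ((h2 s').sub (h1.mul (h3 s'))).const_mul (σ s')).const_mul l).sub (h1.const_mul _))

lemma measurable_expDev_comp {Ω : Type*} {m : MeasurableSpace Ω} (l : ℝ) (σ : St → ℝ) (s : St)
    (a : Ac) {f : Ω → Env St Ac} {g : Ω → St → Ac → St → ℕ} (hf : Measurable f)
    (hg : Measurable g) : Measurable fun ω => expDev l σ s a (f ω) (g ω) :=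
  Measurable.comp (g := fun p : Env St Ac × (St → Ac → St → ℕ) => expDev l σ s a p.1 p.2)
    (f := fun ω => (f ω, g ω)) (measurable_expDev l σ s a) (hf.prodMk hg)

lemma expDev_pos (l : ℝ) (σ : St → ℝ) (s : St) (a : Ac) (M : Env St Ac) (d : St → Ac → St → ℕ) :
    0 < expDev l σ s a M d := Real.exp_pos _

lemma expDev_le (l : ℝ) {σ : St → ℝ} (hσ : ∀ s, |σ s| ≤ 1) (s : St) (a : Ac) (M : Env St Ac)
    {d : St → Ac → St → ℕ} {t : ℕ} (hd : visits d s a ≤ t) :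
    expDev l σ s a M d ≤ Real.exp (|l| * (2 * t)) := by
  refine Real.exp_le_exp.2 ?_
  have h1 : |∑ s', σ s' * ((d s a s' : ℝ) - visits d s a * M.prob s a s')| ≤ 2 * t := by
    calc |∑ s', σ s' * ((d s a s' : ℝ) - visits d s a * M.prob s a s')|
        ≤ ∑ s', |σ s' * ((d s a s' : ℝ) - visits d s a * M.prob s a s')| :=
          Finset.abs_sum_le_sum_abs _ _
      _ ≤ ∑ s', ((d s a s' : ℝ) + visits d s a * M.prob s a s') := by
          refine Finset.sum_le_sum fun s' _ => ?_
          rw [abs_mul]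
          have h0 : 0 ≤ (visits d s a : ℝ) * M.prob s a s' :=
            mul_nonneg (Nat.cast_nonneg _) (M.prob_nonneg s a s')
          have h0' : 0 ≤ (d s a s' : ℝ) := Nat.cast_nonneg _
          have : |(d s a s' : ℝ) - visits d s a * M.prob s a s'|
              ≤ d s a s' + visits d s a * M.prob s a s' := abs_le.2 ⟨by linarith, by linarith⟩
          calc _ ≤ 1 * |(d s a s' : ℝ) - visits d s a * M.prob s a s'| :=
                mul_le_mul_of_nonneg_right (hσ s') (abs_nonneg _)
            _ ≤ _ := by rw [one_mul]; exact this
      _ = 2 * visits d s a := by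
          rw [Finset.sum_add_distrib, ← Finset.mul_sum, M.sum_prob, visits]
          push_cast
          ring
      _ ≤ 2 * t := by exact_mod_cast Nat.mul_le_mul_left 2 hd
  have h2 : l * ∑ s', σ s' * ((d s a s' : ℝ) - visits d s a * M.prob s a s') ≤ |l| * (2 * t) :=
    (le_abs_self _).trans (by rw [abs_mul]; exact mul_le_mul_of_nonneg_left h1 (abs_nonneg l))
  have h3 : 0 ≤ l ^ 2 / 2 * (visits d s a : ℝ) := by positivity
  linarith

variable [DecidableEq St] [DecidableEq Ac]

lemma visits_transCount_le (σ : ℕ → St) (α : ℕ → Ac) (t : ℕ) (s : St) (a : Ac) :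
    visits (transCount σ α t) s a ≤ t := by
  rw [visits_transCount]
  exact (Finset.card_filter_le _ _).trans_eq (Finset.card_range t)

lemma expDev_succ (l : ℝ) (σ : St → ℝ) (s : St) (a : Ac) (M : Env St Ac)
    (x : ℕ → St) (α : ℕ → Ac) (t : ℕ) :
    expDev l σ s a M (transCount x α (t + 1)) = expDev l σ s a M (transCount x α t) *
      if x t = s ∧ α t = a then
        Real.exp (l * (σ (x (t + 1)) - ∑ s', M.prob s a s' * σ s')) * Real.exp (-(l ^ 2 / 2))
      else 1 := by
  simp only [expDev, visits_transCount_succ, transCount_succ]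
  by_cases h : x t = s ∧ α t = a
  · simp only [h, true_and, if_true, ← Real.exp_add, and_self]
    congr 1
    have : ∑ s', σ s' * (((transCount x α t s a s' + if x (t + 1) = s' then 1 else 0 : ℕ) : ℝ)
        - ((visits (transCount x α t) s a + 1 : ℕ) : ℝ) * M.prob s a s')
        = ∑ s', σ s' * ((transCount x α t s a s' : ℝ)
          - (visits (transCount x α t) s a : ℝ) * M.prob s a s')
          + (σ (x (t + 1)) - ∑ s', M.prob s a s' * σ s') := by
      have hone := M.sum_prob s a
      rw [add_sub_assoc', eq_sub_iff_add_eq, ← sub_eq_iff_eq_add']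
      have h1 : σ (x (t + 1)) = ∑ s', if x (t + 1) = s' then σ s' else 0 := by simp
      rw [h1, ← Finset.sum_add_distrib, ← Finset.sum_sub_distrib]
      refine Finset.sum_congr rfl fun s' _ => ?_
      push_cast
      split_ifs <;> ring
    rw [this]
    push_cast
    ring
  · have h' : ∀ s', ¬ (x t = s ∧ α t = a ∧ x (t + 1) = s') := fun s' hh => h ⟨hh.1, hh.2.1⟩
    simp [h, h']

end Confidence

section Run

variable {Ω St Ac : Type*} [Fintype St] [DecidableEq St] [MeasurableSpace St]
  [MeasurableSingletonClass St] [Fintype Ac] [DecidableEq Ac] [MeasurableSpace Ac]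
  [MeasurableSingletonClass Ac] [mΩ : MeasurableSpace Ω]
  {P : Measure Ω} [IsProbabilityMeasure P] {γ : ℝ} {prior : Measure (Env St Ac)} {s₀ : St}
  {planner : Env St Ac → Policy St Ac}
  {E : Ω → Env St Ac} {samp : ℕ → Ω → Env St Ac} {X : ℕ → Ω → Bool}
  {S : ℕ → Ω → St} {A : ℕ → Ω → Ac}
  (hrun : IsRun P γ prior s₀ planner E samp X S A)

/-- The table of transition counts of a run. -/
abbrev counts (S : ℕ → Ω → St) (A : ℕ → Ω → Ac) (t : ℕ) (ω : Ω) : St → Ac → St → ℕ :=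
  transCount (fun i => S i ω) (fun i => A i ω) t

lemma measurable_counts_past (E : Ω → Env St Ac) (samp : ℕ → Ω → Env St Ac) (X : ℕ → Ω → Bool)
    (S : ℕ → Ω → St) (A : ℕ → Ω → Ac) (t : ℕ) :
    Measurable[pastSigma E samp X S A t] (counts S A t) :=
  (measurable_transCount S A t).mono (histSigma_le_past E samp X S A t) le_rfl

include hrun

lemma IsRun.integral_expDev_le (l : ℝ) {σ : St → ℝ} (hσ : ∀ s, |σ s| ≤ 1) (s : St) (a : Ac)
    (t : ℕ) : ∫ ω, expDev l σ s a (E ω) (counts S A t ω) ∂P ≤ 1 := by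
  have hmeas : ∀ t, Measurable[pastSigma E samp X S A t]
      fun ω => expDev l σ s a (E ω) (counts S A t ω) := fun t =>
    measurable_expDev_comp l σ s a (measurable_env_past E samp X S A t)
      (measurable_counts_past E samp X S A t)
  have hbd : ∀ t ω, |expDev l σ s a (E ω) (counts S A t ω)| ≤ Real.exp (|l| * (2 * t)) := by
    intro t ω
    rw [abs_of_pos (expDev_pos _ _ _ _ _ _)]
    exact expDev_le l hσ s a _ (visits_transCount_le _ _ _ _ _)
  have hint : ∀ t, Integrable (fun ω => expDev l σ s a (E ω) (counts S A t ω)) P := fun t =>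
    integrable_of_abs_le ((hmeas t).mono (hrun.pastSigma_le t) le_rfl) (hbd t)
  induction t with
  | zero => simp [expDev, visits, transCount]
  | succ t ih =>
    refine le_trans ?_ ih
    set f : St → Ω → ℝ := fun x ω => expDev l σ s a (E ω) (counts S A t ω) *
      if S t ω = s ∧ A t ω = a then
        Real.exp (l * (σ x - ∑ s', (E ω).prob s a s' * σ s')) * Real.exp (-(l ^ 2 / 2))
      else 1 with hf
    have hpt : pastSigma E samp X S A t ≤ preTransitionSigma E samp X S A t :=
      (pastSigma_le_preAction E samp X S A t).trans (preAction_le_preTransition E samp X S A t)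
    have hE : Measurable[preTransitionSigma E samp X S A t] E :=
      (measurable_env_past E samp X S A t).mono hpt le_rfl
    have hS : Measurable[preTransitionSigma E samp X S A t] (S t) :=
      (measurable_state_hist S A t).mono ((histSigma_le_past E samp X S A t).trans hpt) le_rfl
    have hA := measurable_action_preTransition E samp X S A t
    have hfm : ∀ x, Measurable[preTransitionSigma E samp X S A t] (f x) := by
      intro x
      refine Measurable.mul ((hmeas t).mono hpt le_rfl) (Measurable.ite ?_ ?_ measurable_const)
      · exact MeasurableSet.inter (hS (measurableSet_singleton s)) (hA (measurableSet_singleton a))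
      · exact (Real.measurable_exp.comp ((measurable_const.sub (Finset.measurable_sum _ fun s' _ =>
          ((measurable_prob s a s').comp hE).mul_const _)).const_mul l)).mul_const _
    have hfb : ∀ x ω, |f x ω| ≤ Real.exp (|l| * (2 * t)) * (Real.exp (|l| * 2) + 1) := by
      intro x ω
      rw [hf, abs_mul]
      refine mul_le_mul (hbd t ω) ?_ (abs_nonneg _) (Real.exp_pos _).le
      split_ifs
      · rw [abs_of_pos (by positivity)]
        have h1 : Real.exp (-(l ^ 2 / 2)) ≤ 1 := Real.exp_le_one_iff.2 (by
          have := sq_nonneg l; linarith)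
        have h2 : |∑ s', (E ω).prob s a s' * σ s'| ≤ 1 := by
          calc _ ≤ ∑ s', |(E ω).prob s a s' * σ s'| := Finset.abs_sum_le_sum_abs _ _
            _ ≤ ∑ s', (E ω).prob s a s' := Finset.sum_le_sum fun s' _ => by
                rw [abs_mul, abs_of_nonneg ((E ω).prob_nonneg s a s')]
                exact mul_le_of_le_one_right ((E ω).prob_nonneg s a s') (hσ s')
            _ = 1 := (E ω).sum_prob s a
        have h3 : l * (σ x - ∑ s', (E ω).prob s a s' * σ s') ≤ |l| * 2 := by
          refine (le_abs_self _).trans ?_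
          rw [abs_mul]
          refine mul_le_mul_of_nonneg_left ?_ (abs_nonneg l)
          exact (abs_sub _ _).trans (by linarith [hσ x])
        have h4 := Real.exp_le_exp.2 h3
        have h5 := Real.exp_pos (l * (σ x - ∑ s', (E ω).prob s a s' * σ s'))
        nlinarith
      · rw [abs_one]
        linarith [Real.exp_pos (|l| * 2)]
    have heq : ∀ ω, expDev l σ s a (E ω) (counts S A (t + 1) ω) = f (S (t + 1) ω) ω := fun ω => by
      rw [counts, expDev_succ]
    simp only [heq]
    rw [hrun.integral_transition t hfm hfb]
    refine integral_mono_of_nonneg (Eventually.of_forall fun ω => ?_) (hint t)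
      (Eventually.of_forall fun ω => ?_)
    · refine Finset.sum_nonneg fun x _ => mul_nonneg ((E ω).prob_nonneg _ _ _) ?_
      refine mul_nonneg (expDev_pos _ _ _ _ _ _).le ?_
      split_ifs
      · positivity
      · exact zero_le_one
    · simp only [hf]
      by_cases h : S t ω = s ∧ A t ω = a
      · simp only [h, and_self, if_true]
        have hH := sum_mul_exp_le ((E ω).prob_nonneg s a) ((E ω).sum_prob s a) hσ l
        calc ∑ x, (E ω).prob s a x * (expDev l σ s a (E ω) (counts S A t ω) *
              (Real.exp (l * (σ x - ∑ s', (E ω).prob s a s' * σ s')) * Real.exp (-(l ^ 2 / 2))))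
            = expDev l σ s a (E ω) (counts S A t ω) * Real.exp (-(l ^ 2 / 2)) *
              ∑ x, (E ω).prob s a x * Real.exp (l * (σ x - ∑ s', (E ω).prob s a s' * σ s')) := by
              rw [Finset.mul_sum]
              exact Finset.sum_congr rfl fun x _ => by ring
          _ ≤ expDev l σ s a (E ω) (counts S A t ω) * Real.exp (-(l ^ 2 / 2)) *
              Real.exp (l ^ 2 / 2) :=
              mul_le_mul_of_nonneg_left hH (mul_nonneg (expDev_pos _ _ _ _ _ _).le (Real.exp_pos _).le)
          _ = _ := by rw [mul_assoc, ← Real.exp_add]; simp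
      · simp [h, ← Finset.sum_mul, (E ω).sum_prob]

/-- The true environment lies in the confidence set with high probability. The `ℓ¹`-norm is the
maximum over sign vectors, and on the event that `(s, a)` has been visited `n` times the
exponential bound is used with the parameter `c / √n`. -/
lemma IsRun.prob_notMem_confSet_le {c : ℝ} (hc : 0 ≤ c) (t : ℕ) :
    P.real {ω | E ω ∉ confSet c (counts S A t ω)} ≤
      (Fintype.card St : ℝ) * Fintype.card Ac * 2 ^ Fintype.card St * t *
        Real.exp (-(c ^ 2 / 2)) := by
  let sgn : (St → Bool) → St → ℝ := fun b s => if b s = true then 1 else -1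
  have hsgn : ∀ b s, |sgn b s| ≤ 1 := fun b s => by
    simp only [sgn]; split_ifs <;> simp
  let ev : St × Ac × (St → Bool) × Fin t → Set Ω := fun i =>
    {ω | Real.exp (c ^ 2 / 2) ≤ expDev (c / √((i.2.2.2 : ℕ) + 1 : ℝ)) (sgn i.2.2.1) i.1 i.2.1 (E ω)
      (counts S A t ω)}
  have hev : ∀ i, P.real (ev i) ≤ Real.exp (-(c ^ 2 / 2)) := by
    intro i
    have hm : Measurable fun ω => expDev (c / √((i.2.2.2 : ℕ) + 1 : ℝ)) (sgn i.2.2.1) i.1 i.2.1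
        (E ω) (counts S A t ω) :=
      measurable_expDev_comp _ _ _ _ hrun.measurable_env
        ((measurable_counts_past E samp X S A t).mono (hrun.pastSigma_le t) le_rfl)
    have h1 := mul_meas_ge_le_integral_of_nonneg (μ := P)
      (Eventually.of_forall fun ω => (expDev_pos (c / √((i.2.2.2 : ℕ) + 1 : ℝ)) (sgn i.2.2.1) i.1 i.2.1
        (E ω) (counts S A t ω)).le)
      (integrable_of_abs_le (P := P) hm fun ω => by
        rw [abs_of_pos (expDev_pos _ _ _ _ _ _)]
        exact expDev_le _ (hsgn _) _ _ _ (visits_transCount_le _ _ _ _ _)) (Real.exp (c ^ 2 / 2))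
    have h2 := h1.trans (hrun.integral_expDev_le _ (hsgn _) _ _ t)
    rw [Real.exp_neg, ← one_div]
    exact (le_div_iff₀' (Real.exp_pos _)).2 h2
  have hsub : {ω | E ω ∉ confSet c (counts S A t ω)} ⊆ ⋃ i, ev i := by
    intro ω hω
    simp only [confSet, Set.mem_ofPred_eq, not_forall, not_le] at hω
    obtain ⟨s, a, hsa⟩ := hω
    set d := counts S A t ω with hd
    have hNt : visits d s a ≤ t := visits_transCount_le _ _ _ _ _
    have hN : 0 < visits d s a := by
      rcases Nat.eq_zero_or_pos (visits d s a) with h | h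
      · have h0 : ∀ s', d s a s' = 0 := fun s' =>
          (Finset.sum_eq_zero_iff.1 h) s' (Finset.mem_univ s')
        simp [h, h0] at hsa
      · exact h
    set n := visits d s a with hn
    let b : St → Bool := fun s' => decide ((n : ℝ) * (E ω).prob s a s' ≤ d s a s')
    refine Set.mem_iUnion.2 ⟨(s, a, b, ⟨n - 1, by omega⟩), ?_⟩
    have hcast : (((n - 1 : ℕ) : ℝ) + 1) = n := by
      have : ((n - 1 : ℕ) + 1) = n := by omega
      exact_mod_cast this
    have hn0 : (0 : ℝ) < n := by exact_mod_cast hN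
    have hsq : 0 < √(n : ℝ) := Real.sqrt_pos.2 hn0
    have hss := Real.mul_self_sqrt hn0.le
    have habs : ∑ s', sgn b s' * ((d s a s' : ℝ) - n * (E ω).prob s a s')
        = ∑ s', |(n : ℝ) * (E ω).prob s a s' - d s a s'| := by
      refine Finset.sum_congr rfl fun s' _ => ?_
      simp only [sgn, b, decide_eq_true_eq]
      split_ifs with h
      · rw [abs_of_nonpos (by linarith)]; ring
      · rw [abs_of_pos (by linarith)]; ring
    simp only [ev, Set.mem_ofPred_eq, hcast, expDev, ← hn, ← hd]
    refine Real.exp_le_exp.2 ?_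
    rw [habs]
    have h1 : c / √(n : ℝ) * (c * √(n : ℝ)) ≤ c / √(n : ℝ) *
        ∑ s', |(n : ℝ) * (E ω).prob s a s' - d s a s'| :=
      mul_le_mul_of_nonneg_left hsa.le (by positivity)
    have h2 : c / √(n : ℝ) * (c * √(n : ℝ)) = c ^ 2 := by field_simp
    have h3 : (c / √(n : ℝ)) ^ 2 / 2 * n = c ^ 2 / 2 := by
      rw [div_pow, Real.sq_sqrt hn0.le]; field_simp
    linarith
  calc P.real {ω | E ω ∉ confSet c (counts S A t ω)} ≤ P.real (⋃ i, ev i) :=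
        measureReal_mono hsub
    _ ≤ ∑ i, P.real (ev i) := measureReal_iUnion_fintype_le _
    _ ≤ ∑ _i : St × Ac × (St → Bool) × Fin t, Real.exp (-(c ^ 2 / 2)) :=
        Finset.sum_le_sum fun i _ => hev i
    _ = _ := by
        rw [Finset.sum_const, Finset.card_univ, nsmul_eq_mul]
        simp only [Fintype.card_prod, Fintype.card_fun, Fintype.card_bool, Fintype.card_fin]
        push_cast
        ring

end Run

/-! ### Model errors and value gaps -/

section Gap

variable {St Ac : Type*} [Fintype St] [DecidableEq St] [Fintype Ac]

lemma measurable_discValue (γ : ℝ) (r : St → Ac → ℝ) {Ω : Type*} {m : MeasurableSpace Ω}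
    {f : Ω → Env St Ac} {g : Ω → Policy St Ac} (hf : Measurable f) (hg : Measurable g) (s : St) :
    Measurable fun ω => discValue γ r (f ω) (g ω) s := by
  have hπ : ∀ s a, Measurable fun ω => (g ω).prob s a := fun s a =>
    (measurable_pi_apply a).comp (measurable_subtype_coe.comp ((measurable_pi_apply s).comp hg))
  have hM : ∀ s a s', Measurable fun ω => (f ω).prob s a s' := fun s a s' =>
    (measurable_prob s a s').comp hf
  have hexp : ∀ t s, Measurable fun ω => expReward r (f ω) (g ω) t s := by
    intro t
    induction t with
    | zero =>
      intro s
      have : (fun ω => expReward r (f ω) (g ω) 0 s) = fun ω => ∑ a, (g ω).prob s a * r s a := by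
        funext ω; simp [expReward, rewardVec]
      rw [this]
      exact Finset.measurable_sum _ fun a _ => (hπ s a).mul_const _
    | succ t ih =>
      intro s
      have : (fun ω => expReward r (f ω) (g ω) (t + 1) s) = fun ω => ∑ a, (g ω).prob s a *
          ∑ s', (f ω).prob s a s' * expReward r (f ω) (g ω) t s' := by
        funext ω; rw [expReward_succ, transMat_mulVec]
      rw [this]
      exact Finset.measurable_sum _ fun a _ => (hπ s a).mul
        (Finset.measurable_sum _ fun s' _ => (hM s a s').mul (ih s'))
  exact Measurable.tsum fun h => (hexp h s).const_mul (γ ^ h)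

lemma measurable_eval {α Ω : Type*} [Fintype α] [MeasurableSpace α] [MeasurableSingletonClass α]
    {m : MeasurableSpace Ω} {F : α → Ω → ℝ} (hF : ∀ a, Measurable (F a)) {x : Ω → α}
    (hx : Measurable x) : Measurable fun ω => F (x ω) ω :=
  Measurable.comp (g := fun p : α × Ω => F p.1 p.2) (f := fun ω => (x ω, ω))
    (measurable_from_prod_countable_right hF) (hx.prodMk measurable_id)

/-- The difference between the values, in the environments `M'` and `M`, of the policy planned
for `M'`. -/
def gap (γ : ℝ) (r : St → Ac → ℝ) (planner : Env St Ac → Policy St Ac) (M M' : Env St Ac)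
    (s : St) : ℝ :=
  discValue γ r M' (planner M') s - discValue γ r M (planner M') s

/-- The difference between the expectations of the next value under the transition laws of `M'`
and `M`, for the value in `M'` of the policy planned for `M'`. -/
def modelErr (γ : ℝ) (r : St → Ac → ℝ) (planner : Env St Ac → Policy St Ac) (M M' : Env St Ac)
    (s : St) (a : Ac) : ℝ :=
  ∑ s', (M'.prob s a s' - M.prob s a s') * discValue γ r M' (planner M') s'

section Bounds

variable {γ : ℝ} (h0 : 0 ≤ γ) (h1 : γ < 1) {r : St → Ac → ℝ}
  (hr : ∀ s a, r s a ∈ Set.Icc (0 : ℝ) 1) (planner : Env St Ac → Policy St Ac)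
include h0 h1 hr

lemma abs_gap_le (M M' : Env St Ac) (s : St) : |gap γ r planner M M' s| ≤ 1 / (1 - γ) := by
  have h2 := discValue_mem h0 h1 hr M' (planner M') s
  have h3 := discValue_mem h0 h1 hr M (planner M') s
  exact abs_le.2 ⟨by unfold gap; linarith [h2.1, h3.2], by unfold gap; linarith [h2.2, h3.1]⟩

lemma abs_modelErr_le (M M' : Env St Ac) (s : St) (a : Ac) :
    |modelErr γ r planner M M' s a| ≤ 2 * (1 / (1 - γ)) := by
  calc |modelErr γ r planner M M' s a|
      ≤ ∑ s', |(M'.prob s a s' - M.prob s a s') * discValue γ r M' (planner M') s'| :=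
        Finset.abs_sum_le_sum_abs _ _
    _ ≤ ∑ s', |M'.prob s a s' - M.prob s a s'| * (1 / (1 - γ)) := by
        refine Finset.sum_le_sum fun s' _ => ?_
        have h2 := discValue_mem h0 h1 hr M' (planner M') s'
        rw [abs_mul, abs_of_nonneg h2.1]
        exact mul_le_mul_of_nonneg_left h2.2 (abs_nonneg _)
    _ ≤ 2 * (1 / (1 - γ)) := by
        rw [← Finset.sum_mul]
        exact mul_le_mul_of_nonneg_right (sum_abs_prob_sub_le_two M' M s a)
          (one_div_nonneg.2 (by linarith))

/-- The simulation identity: the value gap is the discounted sum of the model error and of the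
value gap at the next state of the true environment. -/
lemma gap_eq (M M' : Env St Ac) (s : St) : gap γ r planner M M' s =
    ∑ a, (planner M').prob s a * (γ * (modelErr γ r planner M M' s a +
      ∑ s', M.prob s a s' * gap γ r planner M M' s')) := by
  rw [gap, discValue_eq h0 h1 hr M', discValue_eq h0 h1 hr M, transMat_mulVec, transMat_mulVec,
    add_sub_add_left_eq_sub, ← mul_sub, ← Finset.sum_sub_distrib, Finset.mul_sum]
  refine Finset.sum_congr rfl fun a _ => ?_
  have h : modelErr γ r planner M M' s a + ∑ s', M.prob s a s' * gap γ r planner M M' s' =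
      ∑ s', M'.prob s a s' * discValue γ r M' (planner M') s' -
        ∑ s', M.prob s a s' * discValue γ r M (planner M') s' := by
    rw [modelErr, ← Finset.sum_add_distrib, ← Finset.sum_sub_distrib]
    refine Finset.sum_congr rfl fun s' _ => ?_
    rw [gap]
    ring
  rw [h]
  ring

omit h0 h1 hr in
/-- The model error does not change when a constant is subtracted from the values. -/
lemma abs_modelErr_le_of_span {τ k : ℝ} {M M' : Env St Ac} (s : St) (a : Ac)
    (hk : ∀ s, |discValue γ r M' (planner M') s - k| ≤ τ) :
    |modelErr γ r planner M M' s a| ≤ τ * ∑ s', |M'.prob s a s' - M.prob s a s'| := by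
  have h : modelErr γ r planner M M' s a = ∑ s', (M'.prob s a s' - M.prob s a s') *
      (discValue γ r M' (planner M') s' - k) := by
    simp only [modelErr, mul_sub, Finset.sum_sub_distrib]
    rw [← Finset.sum_mul, Finset.sum_sub_distrib, M.sum_prob, M'.sum_prob]
    ring
  rw [h, Finset.mul_sum]
  refine (Finset.abs_sum_le_sum_abs _ _).trans (Finset.sum_le_sum fun s' _ => ?_)
  rw [abs_mul, mul_comm]
  exact mul_le_mul_of_nonneg_right (hk s') (abs_nonneg _)

end Bounds

end Gap

section Run

variable {Ω St Ac : Type*} [Fintype St] [DecidableEq St] [MeasurableSpace St]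
  [MeasurableSingletonClass St] [Fintype Ac] [DecidableEq Ac] [MeasurableSpace Ac]
  [MeasurableSingletonClass Ac] [mΩ : MeasurableSpace Ω]
  {P : Measure Ω} [IsProbabilityMeasure P] {γ : ℝ} {prior : Measure (Env St Ac)} {s₀ : St}
  {planner : Env St Ac → Policy St Ac}
  {E : Ω → Env St Ac} {samp : ℕ → Ω → Env St Ac} {X : ℕ → Ω → Bool}
  {S : ℕ → Ω → St} {A : ℕ → Ω → Ac}
  (h0 : 0 ≤ γ) (h1 : γ < 1) {r : St → Ac → ℝ}
  (hr : ∀ s a, r s a ∈ Set.Icc (0 : ℝ) 1) (hplanner : Measurable planner)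

include hplanner in
lemma measurable_gap {m : MeasurableSpace Ω} {f g : Ω → Env St Ac} (hf : Measurable f)
    (hg : Measurable g) (s : St) : Measurable fun ω => gap γ r planner (f ω) (g ω) s :=
  (measurable_discValue γ r hg (hplanner.comp hg) s).sub
    (measurable_discValue γ r hf (hplanner.comp hg) s)

include hplanner in
lemma measurable_modelErr {m : MeasurableSpace Ω} {f g : Ω → Env St Ac} (hf : Measurable f)
    (hg : Measurable g) (s : St) (a : Ac) :
    Measurable fun ω => modelErr γ r planner (f ω) (g ω) s a :=
  Finset.measurable_sum _ fun s' _ =>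
    (((measurable_prob s a s').comp hg).sub ((measurable_prob s a s').comp hf)).mul
      (measurable_discValue γ r hg (hplanner.comp hg) s')

variable (hrun : IsRun P γ prior s₀ planner E samp X S A)
include h0 h1 hr hplanner hrun

/-- One step of the simulation identity, on an event with indicator `g` known before the action:
the discount factor is the probability that the pseudo-episode continues. -/
lemma integral_gap_step (t : ℕ) {g : Ω → ℝ} (hg : Measurable[preActionSigma E samp X S A t] g)
    (hg1 : ∀ ω, |g ω| ≤ 1) :
    ∫ ω, g ω * gap γ r planner (E ω) (samp t ω) (S t ω) ∂P =
      γ * ∫ ω, g ω * modelErr γ r planner (E ω) (samp t ω) (S t ω) (A t ω) ∂P +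
      ∫ ω in X (t + 1) ⁻¹' {true},
        g ω * gap γ r planner (E ω) (samp (t + 1) ω) (S (t + 1) ω) ∂P := by
  have hpa := pastSigma_le_preAction E samp X S A t
  have hat := preAction_le_preTransition E samp X S A t
  have htc := preTransition_le_preCoin E samp X S A t
  have hE : Measurable[preActionSigma E samp X S A t] E :=
    (measurable_env_past E samp X S A t).mono hpa le_rfl
  have hS : Measurable[preActionSigma E samp X S A t] (S t) :=
    (measurable_state_hist S A t).mono ((histSigma_le_past E samp X S A t).trans hpa) le_rfl
  have hsamp := measurable_samp_preAction E samp X S A t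
  have hA := measurable_action_preTransition E samp X S A t
  have hgap : ∀ s, Measurable[preActionSigma E samp X S A t]
      fun ω => gap γ r planner (E ω) (samp t ω) s := measurable_gap hplanner hE hsamp
  have herr : ∀ s a, Measurable[preActionSigma E samp X S A t]
      fun ω => modelErr γ r planner (E ω) (samp t ω) s a :=
    measurable_modelErr hplanner hE hsamp
  have hgb : ∀ s ω, |g ω * gap γ r planner (E ω) (samp t ω) s| ≤ 1 / (1 - γ) := by
    intro s ω
    rw [abs_mul]
    calc _ ≤ 1 * (1 / (1 - γ)) := mul_le_mul (hg1 ω) (abs_gap_le h0 h1 hr planner _ _ _)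
          (abs_nonneg _) zero_le_one
      _ = _ := one_mul _
  -- the next value gap under the true transition law
  set N : St → Ac → Ω → ℝ := fun s a ω =>
    ∑ s', (E ω).prob s a s' * gap γ r planner (E ω) (samp t ω) s' with hN
  have hNm : ∀ s a, Measurable[preActionSigma E samp X S A t] (N s a) := fun s a =>
    Finset.measurable_sum _ fun s' _ => ((measurable_prob s a s').comp hE).mul (hgap s')
  have hNb : ∀ s a ω, |N s a ω| ≤ 1 / (1 - γ) := by
    intro s a ω
    calc |N s a ω| ≤ ∑ s', |(E ω).prob s a s' * gap γ r planner (E ω) (samp t ω) s'| :=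
          Finset.abs_sum_le_sum_abs _ _
      _ ≤ ∑ s', (E ω).prob s a s' * (1 / (1 - γ)) := Finset.sum_le_sum fun s' _ => by
          rw [abs_mul, abs_of_nonneg ((E ω).prob_nonneg s a s')]
          exact mul_le_mul_of_nonneg_left (abs_gap_le h0 h1 hr planner _ _ _)
            ((E ω).prob_nonneg s a s')
      _ = 1 / (1 - γ) := by rw [← Finset.sum_mul, (E ω).sum_prob, one_mul]
  have hNSAm : Measurable[preTransitionSigma E samp X S A t] fun ω => N (S t ω) (A t ω) ω :=
    measurable_eval (F := fun a ω => N (S t ω) a ω)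
      (fun a => (measurable_eval (fun s => hNm s a) hS).mono hat le_rfl) hA
  have hEm : Measurable[preTransitionSigma E samp X S A t]
      fun ω => modelErr γ r planner (E ω) (samp t ω) (S t ω) (A t ω) :=
    measurable_eval (F := fun a ω => modelErr γ r planner (E ω) (samp t ω) (S t ω) a)
      (fun a => (measurable_eval (fun s => herr s a) hS).mono hat le_rfl) hA
  have hgt : Measurable[preTransitionSigma E samp X S A t] g := hg.mono hat le_rfl
  have hXs : MeasurableSet (X (t + 1) ⁻¹' {true}) :=
    hrun.measurable_coin (t + 1) (measurableSet_singleton true)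
  have e1 : ∫ ω in X (t + 1) ⁻¹' {true},
      g ω * gap γ r planner (E ω) (samp (t + 1) ω) (S (t + 1) ω) ∂P
      = γ * ∫ ω, g ω * N (S t ω) (A t ω) ω ∂P := by
    have e2 : ∫ ω in X (t + 1) ⁻¹' {true},
        g ω * gap γ r planner (E ω) (samp (t + 1) ω) (S (t + 1) ω) ∂P
        = ∫ ω in X (t + 1) ⁻¹' {true},
          g ω * gap γ r planner (E ω) (samp t ω) (S (t + 1) ω) ∂P := by
      refine setIntegral_congr_ae hXs ?_
      filter_upwards [hrun.samp_keep t] with ω h2 h3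
      rw [h2 h3]
    have hm : Measurable[preCoinSigma E samp X S A t]
        fun ω => g ω * gap γ r planner (E ω) (samp t ω) (S (t + 1) ω) :=
      (hgt.mono htc le_rfl).mul (measurable_eval
        (fun s => (hgap s).mono (hat.trans htc) le_rfl) (measurable_state_preCoin E samp X S A t))
    rw [e2, hrun.integral_continue t hm (integrable_of_abs_le
      (hm.mono (hrun.preCoinSigma_le t) le_rfl) fun ω => hgb _ ω)]
    congr 1
    rw [hrun.integral_transition t
      (f := fun s ω => g ω * gap γ r planner (E ω) (samp t ω) s)
      (fun s => hgt.mul ((hgap s).mono hat le_rfl)) hgb]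
    refine integral_congr_ae (Eventually.of_forall fun ω => ?_)
    simp only [hN, Finset.mul_sum]
    exact Finset.sum_congr rfl fun s' _ => by ring
  have hi1 : Integrable (fun ω => g ω *
      modelErr γ r planner (E ω) (samp t ω) (S t ω) (A t ω)) P := by
    refine integrable_of_abs_le ((hgt.mul hEm).mono (hrun.preTransitionSigma_le t) le_rfl)
      (c := 1 * (2 * (1 / (1 - γ)))) fun ω => ?_
    rw [abs_mul]
    exact mul_le_mul (hg1 ω) (abs_modelErr_le h0 h1 hr planner _ _ _ _) (abs_nonneg _) zero_le_one
  have hi2 : Integrable (fun ω => g ω * N (S t ω) (A t ω) ω) P := by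
    refine integrable_of_abs_le ((hgt.mul hNSAm).mono (hrun.preTransitionSigma_le t) le_rfl)
      (c := 1 * (1 / (1 - γ))) fun ω => ?_
    rw [abs_mul]
    exact mul_le_mul (hg1 ω) (hNb _ _ _) (abs_nonneg _) zero_le_one
  rw [e1, ← mul_add, ← integral_add hi1 hi2, ← integral_const_mul]
  have e3 := hrun.integral_action t
    (f := fun a ω => γ * (g ω * modelErr γ r planner (E ω) (samp t ω) (S t ω) a +
      g ω * N (S t ω) a ω)) (c := γ * (1 * (2 * (1 / (1 - γ))) + 1 * (1 / (1 - γ))))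
    (fun a => ((hg.mul (measurable_eval (fun s => herr s a) hS)).add
      (hg.mul (measurable_eval (fun s => hNm s a) hS))).const_mul γ)
    (fun a ω => by
      rw [abs_mul, abs_of_nonneg h0]
      refine mul_le_mul_of_nonneg_left ((abs_add_le _ _).trans (add_le_add ?_ ?_)) h0
      · rw [abs_mul]
        exact mul_le_mul (hg1 ω) (abs_modelErr_le h0 h1 hr planner _ _ _ _) (abs_nonneg _)
          zero_le_one
      · rw [abs_mul]
        exact mul_le_mul (hg1 ω) (hNb _ _ _) (abs_nonneg _) zero_le_one)
  rw [e3]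
  refine integral_congr_ae (Eventually.of_forall fun ω => ?_)
  beta_reduce
  rw [gap_eq h0 h1 hr planner, Finset.mul_sum]
  exact Finset.sum_congr rfl fun a _ => by simp only [hN]; ring

/-- Posterior sampling: at the start of a pseudo-episode the optimal value of the true environment
has the same expectation as that of the sampled one. -/
lemma integral_discRegret (hopt : ∀ M, IsDiscOptimal γ r M (planner M)) (T : ℕ) :
    Integrable (discRegret γ r planner E samp X S T) P ∧
    ∫ ω, discRegret γ r planner E samp X S T ω ∂P = ∑ t ∈ Finset.range T,
      ∫ ω in X t ⁻¹' {false}, gap γ r planner (E ω) (samp t ω) (S t ω) ∂P := by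
  have hS := hrun.measurable_state
  have hE := hrun.measurable_env
  have hsp := hrun.measurable_samp
  have hXs : ∀ t, MeasurableSet (X t ⁻¹' {false}) := fun t =>
    hrun.measurable_coin t (measurableSet_singleton false)
  have hmV : ∀ {f g : Ω → Env St Ac}, Measurable f → Measurable g → ∀ t,
      Integrable (fun ω => discValue γ r (f ω) (planner (g ω)) (S t ω)) P := by
    intro f g hf hg t
    refine integrable_of_abs_le (c := 1 / (1 - γ))
      (measurable_eval (fun s => measurable_discValue γ r hf (hplanner.comp hg) s) (hS t))
      fun ω => ?_
    have := discValue_mem h0 h1 hr (f ω) (planner (g ω)) (S t ω)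
    rw [abs_of_nonneg this.1]
    exact this.2
  have hreg : discRegret γ r planner E samp X S T = fun ω => ∑ t ∈ Finset.range T,
      (X t ⁻¹' {false}).indicator (fun ω => discValue γ r (E ω) (planner (E ω)) (S t ω)
        - discValue γ r (E ω) (planner (samp t ω)) (S t ω)) ω := by
    funext ω
    rw [discRegret, Finset.sum_filter]
    refine Finset.sum_congr rfl fun t _ => ?_
    rw [← hopt (E ω) (S t ω)]
    by_cases h : X t ω = false
    · rw [if_pos h, Set.indicator_of_mem (show ω ∈ X t ⁻¹' {false} from h)]
    · rw [if_neg h, Set.indicator_of_notMem (show ω ∉ X t ⁻¹' {false} from h)]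
  have hint : ∀ t, Integrable ((X t ⁻¹' {false}).indicator
      (fun ω => discValue γ r (E ω) (planner (E ω)) (S t ω)
        - discValue γ r (E ω) (planner (samp t ω)) (S t ω))) P := fun t =>
    ((hmV hE hE t).sub (hmV hE (hsp t) t)).indicator (hXs t)
  rw [hreg]
  refine ⟨integrable_finsetSum _ fun t _ => hint t, ?_⟩
  rw [integral_finsetSum _ fun t _ => hint t]
  refine Finset.sum_congr rfl fun t _ => ?_
  rw [integral_indicator (hXs t), integral_sub (hmV hE hE t).integrableOn
    (hmV hE (hsp t) t).integrableOn]
  have hlaw := hrun.map_samp_eq_map_env t (measurable_state_hist S A t)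
  have hF : Measurable fun p : Env St Ac × St => discValue γ r p.1 (planner p.1) p.2 :=
    measurable_eval (F := fun s (p : Env St Ac × St) => discValue γ r p.1 (planner p.1) s)
      (fun s => measurable_discValue γ r measurable_fst (hplanner.comp measurable_fst) s)
      measurable_snd
  have e := congrArg (fun μ => ∫ p, discValue γ r p.1 (planner p.1) p.2 ∂μ) hlaw
  rw [integral_map ((hsp t).prodMk (hS t)).aemeasurable hF.aestronglyMeasurable,
    integral_map (hE.prodMk (hS t)).aemeasurable hF.aestronglyMeasurable] at e
  rw [← e, ← integral_sub (hmV (hsp t) (hsp t) t).integrableOn (hmV hE (hsp t) t).integrableOn]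
  rfl

end Run

/-! ### Active steps and the regret decomposition -/

section Active

variable {Ω St Ac : Type*} [Fintype St] [DecidableEq St] [Fintype Ac] [DecidableEq Ac]
  (c : ℝ) (m₀ : ℕ) (E : Ω → Env St Ac) (samp : ℕ → Ω → Env St Ac) (X : ℕ → Ω → Bool)
  (S : ℕ → Ω → St) (A : ℕ → Ω → Ac)

/-- The step at which the pseudo-episode in progress at step `t` started. -/
def startTime (t : ℕ) (ω : Ω) : ℕ := held (fun u => X u ω) (fun u => u) t

/-- The transition counts at the start of the pseudo-episode in progress at step `t`. -/
def heldCounts (t : ℕ) (ω : Ω) : St → Ac → St → ℕ :=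
  held (fun u => X u ω) (fun u => counts S A u ω) t

/-- Step `t` is active if the true and the sampled environment both lie in the confidence set
computed when the pseudo-episode started, the pseudo-episode is younger than `m₀` steps, and since
its start no number of visits has reached four times its value (or `4`, from the value `0`). -/
def active (t : ℕ) : Set Ω :=
  {ω | E ω ∈ confSet c (heldCounts X S A t ω) ∧ samp t ω ∈ confSet c (heldCounts X S A t ω) ∧
    t < startTime X t ω + m₀ ∧
    ∀ s a, visits (counts S A t ω) s a < 4 * max 1 (visits (heldCounts X S A t ω) s a)}

/-- A pseudo-episode continues but ceases to be active at step `t + 1`. -/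
def deactivation (t : ℕ) : Set Ω :=
  (X (t + 1) ⁻¹' {true} ∩ active c m₀ E samp X S A t) \ active c m₀ E samp X S A (t + 1)

variable {c m₀ E samp X S A}

lemma visits_counts_mono (ω : Ω) (s : St) (a : Ac) :
    Monotone fun t => visits (counts S A t ω) s a :=
  monotone_nat_of_le_succ fun t => by rw [counts, counts, visits_transCount_succ]; omega

lemma active_of_succ {t : ℕ} {ω : Ω} (hX : X (t + 1) ω = true)
    (hs : samp (t + 1) ω = samp t ω) (h : ω ∈ active c m₀ E samp X S A (t + 1)) :
    ω ∈ active c m₀ E samp X S A t := by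
  obtain ⟨h1, h2, h3, h4⟩ := h
  simp only [heldCounts, startTime, held_succ_of_true (x := fun u => X u ω) hX, hs] at h1 h2 h3 h4
  exact ⟨h1, h2, (Nat.lt_succ_self t).trans h3, fun s a =>
    (visits_counts_mono ω s a (Nat.le_succ t)).trans_lt (h4 s a)⟩

/-- Apart from old pseudo-episodes, activity only ends when some number of visits quadruples,
while its value at the start of the pseudo-episode was below `m / 3`. -/
lemma exists_quadrupling_of_mem_deactivation {m : ℝ} (hm : (m₀ : ℝ) < m + 1) {t : ℕ} {ω : Ω}
    (hs : samp (t + 1) ω = samp t ω) (h : ω ∈ deactivation c m₀ E samp X S A t)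
    (hage : ¬ startTime X (t + 1) ω + m₀ ≤ t + 1) :
    ∃ p : St × Ac, X (t + 1) ω = true ∧
      visits (counts S A t ω) p.1 p.2 < 4 * max 1 (visits (heldCounts X S A t ω) p.1 p.2) ∧
      4 * max 1 (visits (heldCounts X S A t ω) p.1 p.2)
        ≤ visits (counts S A (t + 1) ω) p.1 p.2 ∧
      3 * ((max 1 (visits (heldCounts X S A t ω) p.1 p.2) : ℕ) : ℝ) < m := by
  obtain ⟨⟨hX, h1, h2, h3, h4⟩, h5⟩ := h
  have hX' : X (t + 1) ω = true := hX
  have hheld : heldCounts X S A (t + 1) ω = heldCounts X S A t ω :=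
    held_succ_of_true (x := fun u => X u ω) hX'
  have : ∃ p : St × Ac, 4 * max 1 (visits (heldCounts X S A t ω) p.1 p.2)
      ≤ visits (counts S A (t + 1) ω) p.1 p.2 := by
    by_contra! hcon
    exact h5 ⟨hheld ▸ h1, by rw [hheld, hs]; exact h2, not_le.1 hage,
      fun s a => by rw [hheld]; exact hcon (s, a)⟩
  obtain ⟨p, hp⟩ := this
  refine ⟨p, hX', h4 p.1 p.2, hp, ?_⟩
  have hgrow := le_held_add_age (fun u => X u ω)
    (N := fun u => visits (counts S A u ω) p.1 p.2)
    (fun u => by simp only [counts, visits_transCount_succ]; split_ifs <;> omega) (t + 1)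
  rw [held_comp (fun d => visits d p.1 p.2) (fun u => X u ω) (fun u => counts S A u ω)] at hgrow
  change _ + startTime X (t + 1) ω ≤ visits (heldCounts X S A (t + 1) ω) p.1 p.2 + _ at hgrow
  rw [hheld] at hgrow
  have h3 : 3 * max 1 (visits (heldCounts X S A t ω) p.1 p.2) + 1 ≤ m₀ := by omega
  have h3' : 3 * ((max 1 (visits (heldCounts X S A t ω) p.1 p.2) : ℕ) : ℝ) + 1 ≤ m₀ := by
    exact_mod_cast h3
  linarith

end Active

section Run

variable {Ω St Ac : Type*} [Fintype St] [DecidableEq St] [MeasurableSpace St]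
  [MeasurableSingletonClass St] [Fintype Ac] [DecidableEq Ac] [MeasurableSpace Ac]
  [MeasurableSingletonClass Ac] [mΩ : MeasurableSpace Ω]
  {P : Measure Ω} [IsProbabilityMeasure P] {γ : ℝ} {prior : Measure (Env St Ac)} {s₀ : St}
  {planner : Env St Ac → Policy St Ac}
  {E : Ω → Env St Ac} {samp : ℕ → Ω → Env St Ac} {X : ℕ → Ω → Bool}
  {S : ℕ → Ω → St} {A : ℕ → Ω → Ac}

lemma measurable_startTime (E : Ω → Env St Ac) (samp : ℕ → Ω → Env St Ac) (X : ℕ → Ω → Bool)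
    (S : ℕ → Ω → St) (A : ℕ → Ω → Ac) (t : ℕ) :
    Measurable[pastSigma E samp X S A t] (startTime X t) :=
  measurable_held E samp X S A (Y := fun u _ => u) t fun _ _ => measurable_const

lemma measurable_heldCounts (E : Ω → Env St Ac) (samp : ℕ → Ω → Env St Ac) (X : ℕ → Ω → Bool)
    (S : ℕ → Ω → St) (A : ℕ → Ω → Ac) (t : ℕ) :
    Measurable[pastSigma E samp X S A t] (heldCounts X S A t) :=
  measurable_held E samp X S A (Y := fun u => counts S A u) t fun u hu =>
    (measurable_counts_past E samp X S A u).mono (pastSigma_mono E samp X S A hu) le_rfl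

lemma measurableSet_mem_confSet {m : MeasurableSpace Ω} {c : ℝ} {f : Ω → Env St Ac}
    {g : Ω → St → Ac → St → ℕ} (hf : Measurable f) (hg : Measurable g) :
    MeasurableSet {ω | f ω ∈ confSet c (g ω)} :=
  (hf.prodMk hg) (measurableSet_confSet c)

lemma measurableSet_active (c : ℝ) (m₀ : ℕ) (t : ℕ) :
    MeasurableSet[preActionSigma E samp X S A t] (active c m₀ E samp X S A t) := by
  have hpa := pastSigma_le_preAction E samp X S A t
  have hE := (measurable_env_past E samp X S A t).mono hpa le_rfl
  have hH := (measurable_heldCounts E samp X S A t).mono hpa le_rfl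
  have hZ := (measurable_counts_past E samp X S A t).mono hpa le_rfl
  have hT := (measurable_startTime E samp X S A t).mono hpa le_rfl
  refine MeasurableSet.inter (measurableSet_mem_confSet hE hH) (MeasurableSet.inter
    (measurableSet_mem_confSet (measurable_samp_preAction E samp X S A t) hH)
    (MeasurableSet.inter ?_ ?_))
  · exact hT (MeasurableSet.of_discrete (s := {n | t < n + m₀}))
  · exact (hZ.prodMk hH) (Set.to_countable
      {p : (St → Ac → St → ℕ) × (St → Ac → St → ℕ) |
        ∀ s a, visits p.1 s a < 4 * max 1 (visits p.2 s a)}).measurableSet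

variable (hrun : IsRun P γ prior s₀ planner E samp X S A)
include hrun

lemma IsRun.measurableSet_active (c : ℝ) (m₀ : ℕ) (t : ℕ) :
    MeasurableSet (active c m₀ E samp X S A t) :=
  hrun.preActionSigma_le t _ (CPSRL.measurableSet_active c m₀ t)

lemma IsRun.measurableSet_coin (t : ℕ) (b : Bool) : MeasurableSet (X t ⁻¹' {b}) :=
  hrun.measurable_coin t (measurableSet_singleton b)

lemma IsRun.measurableSet_deactivation (c : ℝ) (m₀ : ℕ) (t : ℕ) :
    MeasurableSet (deactivation c m₀ E samp X S A t) :=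
  ((hrun.measurableSet_coin (t + 1) true).inter (hrun.measurableSet_active c m₀ t)).diff
    (hrun.measurableSet_active c m₀ (t + 1))

/-- The decomposition of the expected regret. The simulation identity is telescoped over the
active steps; where activity ends, where a pseudo-episode starts inactive, and after the last step,
the remaining value gap is bounded by `1 / (1 - γ)`. -/
lemma integral_discRegret_le (h0 : 0 ≤ γ) (h1 : γ < 1) {r : St → Ac → ℝ}
    (hr : ∀ s a, r s a ∈ Set.Icc (0 : ℝ) 1) (hplanner : Measurable planner)
    (hopt : ∀ M, IsDiscOptimal γ r M (planner M)) (c : ℝ) (m₀ T : ℕ) :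
    ∫ ω, discRegret γ r planner E samp X S (T + 1) ω ∂P ≤
      γ * ∑ t ∈ Finset.range (T + 1), ∫ ω in active c m₀ E samp X S A t,
        modelErr γ r planner (E ω) (samp t ω) (S t ω) (A t ω) ∂P +
      1 / (1 - γ) * (1 + ∑ t ∈ Finset.range T, P.real (deactivation c m₀ E samp X S A t) +
        ∑ t ∈ Finset.range (T + 1),
          P.real (X t ⁻¹' {false} \ active c m₀ E samp X S A t)) := by
  set b := 1 / (1 - γ) with hb
  have hb0 : 0 ≤ b := one_div_nonneg.2 (by linarith)
  set D : ℕ → Ω → ℝ := fun t ω => gap γ r planner (E ω) (samp t ω) (S t ω) with hD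
  set act : ℕ → Set Ω := fun t => active c m₀ E samp X S A t with hact
  have hDm : ∀ t, Measurable (D t) := fun t =>
    measurable_eval (F := fun s ω => gap γ r planner (E ω) (samp t ω) s)
      (fun s => measurable_gap hplanner hrun.measurable_env (hrun.measurable_samp t) s)
      (hrun.measurable_state t)
  have hDb : ∀ t ω, |D t ω| ≤ b := fun t ω => abs_gap_le h0 h1 hr planner _ _ _
  have hDi : ∀ t, Integrable (D t) P := fun t => integrable_of_abs_le (hDm t) (hDb t)
  have hset : ∀ t (s : Set Ω), ∫ ω in s, D t ω ∂P ≤ b * P.real s := fun t s =>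
    (Real.le_norm_self _).trans (norm_setIntegral_le_of_norm_le_const (f := D t)
      (measure_lt_top P s) fun ω _ => hDb t ω)
  have hactm : ∀ t, MeasurableSet (act t) := hrun.measurableSet_active c m₀
  have hXm := hrun.measurableSet_coin
  set u : ℕ → ℝ := fun t => ∫ ω in act t ∩ X t ⁻¹' {true}, D t ω ∂P with hu
  set v : ℕ → ℝ := fun t => ∫ ω in X (t + 1) ⁻¹' {true} ∩ act t, D (t + 1) ω ∂P with hv
  have hu0 : u 0 = 0 := by
    refine setIntegral_measure_zero _ (measure_mono_null Set.inter_subset_right ?_)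
    have := hrun.init_coin
    rw [ae_iff] at this
    convert this using 2
    ext ω
    simp
  have hstep : ∀ t, ∫ ω in X t ⁻¹' {false}, D t ω ∂P ≤
      γ * ∫ ω in act t, modelErr γ r planner (E ω) (samp t ω) (S t ω) (A t ω) ∂P
        + v t - u t + b * P.real (X t ⁻¹' {false} \ act t) := by
    intro t
    have e1 := integral_inter_add_sdiff (s := X t ⁻¹' {false}) (hactm t) (hDi t).integrableOn
    have e2 := integral_inter_add_sdiff (s := act t) (hXm t true) (hDi t).integrableOn
    have e3 : act t \ X t ⁻¹' {true} = X t ⁻¹' {false} ∩ act t := by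
      ext ω; simp [and_comm]
    have e4 := integral_gap_step h0 h1 hr hplanner hrun t (g := (act t).indicator fun _ => 1)
      (Measurable.indicator measurable_const (CPSRL.measurableSet_active c m₀ t))
      (fun ω => by by_cases h : ω ∈ act t <;> simp [h])
    have hmul : ∀ f : Ω → ℝ, (fun ω => (act t).indicator (fun _ => (1 : ℝ)) ω * f ω)
        = (act t).indicator f := fun f => by
      funext ω; by_cases h : ω ∈ act t <;> simp [h]
    rw [hmul, hmul, hmul, integral_indicator (hactm t), integral_indicator (hactm t),
      setIntegral_indicator (hactm t)] at e4
    have e5 := hset t (X t ⁻¹' {false} \ act t)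
    rw [e3] at e2
    change ∫ ω in act t, D t ω ∂P = _ + v t at e4
    change u t + _ = _ at e2
    linarith
  have hvu : ∀ t, v t ≤ u (t + 1) + b * P.real (deactivation c m₀ E samp X S A t) := by
    intro t
    have e1 := integral_inter_add_sdiff (s := X (t + 1) ⁻¹' {true} ∩ act t) (hactm (t + 1))
      (hDi (t + 1)).integrableOn
    have e2 : ∫ ω in (X (t + 1) ⁻¹' {true} ∩ act t) ∩ act (t + 1), D (t + 1) ω ∂P = u (t + 1) := by
      refine setIntegral_congr_set ?_
      filter_upwards [hrun.samp_keep t] with ω hω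
      refine propext ⟨fun h => ⟨h.2, h.1.1⟩, fun h => ⟨⟨h.2, active_of_succ h.2 (hω h.2) h.1⟩, h.1⟩⟩
    have e3 := hset (t + 1) (deactivation c m₀ E samp X S A t)
    change _ + ∫ ω in deactivation c m₀ E samp X S A t, D (t + 1) ω ∂P = v t at e1
    linarith
  have hvT : v T ≤ b := (hset _ _).trans (mul_le_of_le_one_right hb0 measureReal_le_one)
  rw [(integral_discRegret h0 h1 hr hplanner hrun hopt (T + 1)).2]
  have hsum := Finset.sum_le_sum fun t (_ : t ∈ Finset.range (T + 1)) => hstep t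
  have hsumv := Finset.sum_le_sum fun t (_ : t ∈ Finset.range T) => hvu t
  simp only [Finset.sum_add_distrib, Finset.sum_sub_distrib, ← Finset.mul_sum] at hsum hsumv
  rw [Finset.sum_range_succ v, Finset.sum_range_succ' u] at hsum
  rw [mul_add, mul_add, mul_one]
  linarith

/-- A pseudo-episode that starts at step `t` is inactive only if one of the environments is
outside of the confidence set; both events have the same probability. -/
lemma IsRun.prob_start_inactive_le (c : ℝ) {m₀ : ℕ} (hm₀ : 0 < m₀) (t : ℕ) :
    P.real (X t ⁻¹' {false} \ active c m₀ E samp X S A t) ≤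
      2 * ((1 - γ) * P.real {ω | E ω ∉ confSet c (counts S A t ω)}) := by
  have hZh : Measurable[histSigma S A t] (counts S A t) := measurable_transCount S A t
  have hZ : Measurable (counts S A t) := (measurable_counts_past E samp X S A t).mono
    (hrun.pastSigma_le t) le_rfl
  set Q : Set (Env St Ac × (St → Ac → St → ℕ)) := {p | p.1 ∈ confSet c p.2} with hQ
  have hQm : MeasurableSet Q := measurableSet_confSet c
  have hXm := hrun.measurableSet_coin t false
  have heq : P (X t ⁻¹' {false} ∩ {ω | samp t ω ∉ confSet c (counts S A t ω)}) =
      P (X t ⁻¹' {false} ∩ {ω | E ω ∉ confSet c (counts S A t ω)}) := by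
    have h := congrArg (fun μ => μ Qᶜ) (hrun.map_samp_eq_map_env t hZh)
    beta_reduce at h
    rw [Measure.map_apply ((hrun.measurable_samp t).prodMk hZ) hQm.compl,
      Measure.map_apply (hrun.measurable_env.prodMk hZ) hQm.compl,
      Measure.restrict_apply (((hrun.measurable_samp t).prodMk hZ) hQm.compl),
      Measure.restrict_apply ((hrun.measurable_env.prodMk hZ) hQm.compl)] at h
    rw [Set.inter_comm, Set.inter_comm (X t ⁻¹' {false})]
    exact h
  have hBm' : MeasurableSet[MeasurableSpace.comap E inferInstance ⊔ histSigma S A t]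
      {ω | E ω ∉ confSet c (counts S A t ω)} := by
    have hE' : Measurable[MeasurableSpace.comap E inferInstance ⊔ histSigma S A t] E :=
      (comap_measurable E).mono le_sup_left le_rfl
    have hZ' : Measurable[MeasurableSpace.comap E inferInstance ⊔ histSigma S A t]
      (counts S A t) := hZh.mono le_sup_right le_rfl
    exact (measurableSet_mem_confSet hE' hZ').compl
  have hBm : MeasurableSet {ω | E ω ∉ confSet c (counts S A t ω)} :=
    (measurableSet_mem_confSet hrun.measurable_env hZ).compl
  have hEb : P.real (X t ⁻¹' {false} ∩ {ω | E ω ∉ confSet c (counts S A t ω)}) ≤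
      (1 - γ) * P.real {ω | E ω ∉ confSet c (counts S A t ω)} := by
    have h := hrun.integral_start t (f := {ω | E ω ∉ confSet c (counts S A t ω)}.indicator
      fun _ => (1 : ℝ)) (measurable_const.indicator hBm') ((integrable_const _).indicator hBm)
    rw [setIntegral_indicator hBm, integral_indicator hBm, setIntegral_const, setIntegral_const,
      smul_eq_mul, mul_one, smul_eq_mul, mul_one] at h
    rw [h]
    cases t with
    | zero =>
      have : {ω | E ω ∉ confSet c (counts S A 0 ω)} = ∅ := by
        ext ω
        simp [confSet, counts, transCount, visits]
      simp [this]
    | succ t => exact le_rfl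
  have hsub : X t ⁻¹' {false} \ active c m₀ E samp X S A t ⊆
      (X t ⁻¹' {false} ∩ {ω | E ω ∉ confSet c (counts S A t ω)}) ∪
      (X t ⁻¹' {false} ∩ {ω | samp t ω ∉ confSet c (counts S A t ω)}) := by
    rintro ω ⟨hX, hω⟩
    by_contra hcon
    have hX' : X t ω = false := hX
    have hh : heldCounts X S A t ω = counts S A t ω := held_of_false (x := fun u => X u ω) hX'
    have hst : startTime X t ω = t := held_of_false (x := fun u => X u ω) hX'
    have h1 : E ω ∈ confSet c (counts S A t ω) := by
      by_contra h; exact hcon (Or.inl ⟨hX, h⟩)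
    have h2 : samp t ω ∈ confSet c (counts S A t ω) := by
      by_contra h; exact hcon (Or.inr ⟨hX, h⟩)
    refine hω ⟨hh ▸ h1, hh ▸ h2, by omega, fun s a => ?_⟩
    rw [hh]
    omega
  have hle := (measureReal_mono (μ := P) hsub).trans (measureReal_union_le _ _)
  have heq' : P.real (X t ⁻¹' {false} ∩ {ω | samp t ω ∉ confSet c (counts S A t ω)}) =
      P.real (X t ⁻¹' {false} ∩ {ω | E ω ∉ confSet c (counts S A t ω)}) := by
    simp only [measureReal_def, heq]
  rw [heq'] at hle
  linarith

/-- The age of a pseudo-episode has geometric tails. -/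
lemma IsRun.prob_age_le (h0 : 0 ≤ γ) (n t : ℕ) :
    P.real {ω | startTime X t ω + n ≤ t} ≤ γ ^ n := by
  induction n generalizing t with
  | zero => simp
  | succ n ih =>
    cases t with
    | zero =>
      have : {ω | startTime X 0 ω + (n + 1) ≤ 0} = ∅ := by ext ω; simp
      rw [this]
      simp [pow_nonneg h0 (n + 1)]
    | succ t =>
      have hm : MeasurableSet[preCoinSigma E samp X S A t] {ω | startTime X t ω + n ≤ t} := by
        have h := ((measurable_startTime E samp X S A t).mono
          ((pastSigma_le_preAction E samp X S A t).trans
            ((preAction_le_preTransition E samp X S A t).trans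
              (preTransition_le_preCoin E samp X S A t))) le_rfl)
        exact h (MeasurableSet.of_discrete (s := {k | k + n ≤ t}))
      have hm' := hrun.preCoinSigma_le t _ hm
      have h := hrun.integral_continue t (f := {ω | startTime X t ω + n ≤ t}.indicator
        fun _ => (1 : ℝ)) (measurable_const.indicator hm) ((integrable_const _).indicator hm')
      rw [setIntegral_indicator hm', integral_indicator hm', setIntegral_const, setIntegral_const,
        smul_eq_mul, mul_one, smul_eq_mul, mul_one] at h
      have hsub : {ω | startTime X (t + 1) ω + (n + 1) ≤ t + 1} ⊆
          X (t + 1) ⁻¹' {true} ∩ {ω | startTime X t ω + n ≤ t} := by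
        intro ω (hω : startTime X (t + 1) ω + (n + 1) ≤ t + 1)
        have hX : X (t + 1) ω = true := by
          by_contra hcon
          have : startTime X (t + 1) ω = t + 1 :=
            held_of_false (x := fun u => X u ω) (by simpa using hcon)
          omega
        have hst : startTime X (t + 1) ω = startTime X t ω :=
          held_succ_of_true (x := fun u => X u ω) hX
        refine ⟨hX, ?_⟩
        change startTime X t ω + n ≤ t
        omega
      calc P.real {ω | startTime X (t + 1) ω + (n + 1) ≤ t + 1}
          ≤ γ * P.real {ω | startTime X t ω + n ≤ t} := (measureReal_mono hsub).trans_eq h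
        _ ≤ γ * γ ^ n := mul_le_mul_of_nonneg_left (ih t) h0
        _ = γ ^ (n + 1) := by rw [pow_succ, mul_comm]

lemma IsRun.sum_prob_deactivation_le (h0 : 0 ≤ γ) (c : ℝ) {m₀ : ℕ} {m : ℝ} (hm1 : 1 ≤ m)
    (hm : (m₀ : ℝ) < m + 1) (T : ℕ) :
    ∑ t ∈ Finset.range T, P.real (deactivation c m₀ E samp X S A t) ≤
      T * γ ^ m₀ + (Fintype.card St : ℝ) * Fintype.card Ac * Real.log m := by
  classical
  set old : ℕ → Set Ω := fun t => {ω | startTime X (t + 1) ω + m₀ ≤ t + 1} with hold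
  have holdm : ∀ t, MeasurableSet (old t) := fun t =>
    ((measurable_startTime E samp X S A (t + 1)).mono (hrun.pastSigma_le (t + 1)) le_rfl)
      (MeasurableSet.of_discrete (s := {k | k + m₀ ≤ t + 1}))
  have hsm : ∀ t, MeasurableSet (deactivation c m₀ E samp X S A t \ old t) := fun t =>
    (hrun.measurableSet_deactivation c m₀ t).diff (holdm t)
  have hsplit : ∀ t, P.real (deactivation c m₀ E samp X S A t) ≤
      γ ^ m₀ + P.real (deactivation c m₀ E samp X S A t \ old t) := by
    intro t
    have : deactivation c m₀ E samp X S A t ⊆ old t ∪ deactivation c m₀ E samp X S A t \ old t := by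
      rw [Set.union_sdiff_self]; exact Set.subset_union_right
    refine ((measureReal_mono this).trans (measureReal_union_le _ _)).trans ?_
    exact add_le_add (hrun.prob_age_le h0 m₀ (t + 1)) le_rfl
  have hint : ∀ t, Integrable ((deactivation c m₀ E samp X S A t \ old t).indicator
      fun _ => (1 : ℝ)) P := fun t => (integrable_const _).indicator (hsm t)
  have hpath : ∑ t ∈ Finset.range T, P.real (deactivation c m₀ E samp X S A t \ old t) ≤
      (Fintype.card St : ℝ) * Fintype.card Ac * Real.log m := by
    have e : ∑ t ∈ Finset.range T, P.real (deactivation c m₀ E samp X S A t \ old t) =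
        ∫ ω, ∑ t ∈ Finset.range T,
          (deactivation c m₀ E samp X S A t \ old t).indicator (fun _ => (1 : ℝ)) ω ∂P := by
      rw [integral_finsetSum _ fun t _ => hint t]
      refine Finset.sum_congr rfl fun t _ => ?_
      rw [integral_indicator (hsm t), setIntegral_const, smul_eq_mul, mul_one]
    rw [e]
    have hae : ∀ᵐ ω ∂P, ∀ t, X (t + 1) ω = true → samp (t + 1) ω = samp t ω :=
      ae_all_iff.2 hrun.samp_keep
    calc _ ≤ ∫ _, (Fintype.card St : ℝ) * Fintype.card Ac * Real.log m ∂P := by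
          refine integral_mono_ae (integrable_finsetSum _ fun t _ => hint t)
            (integrable_const _) ?_
          filter_upwards [hae] with ω hω
          set Q : St × Ac → ℕ → Prop := fun p t => X (t + 1) ω = true ∧
            visits (counts S A t ω) p.1 p.2 < 4 * max 1 (visits (heldCounts X S A t ω) p.1 p.2) ∧
            4 * max 1 (visits (heldCounts X S A t ω) p.1 p.2)
              ≤ visits (counts S A (t + 1) ω) p.1 p.2 ∧
            3 * ((max 1 (visits (heldCounts X S A t ω) p.1 p.2) : ℕ) : ℝ) < m with hQ
          have hle : ∀ t, (deactivation c m₀ E samp X S A t \ old t).indicator (fun _ => (1 : ℝ)) ω ≤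
              ∑ p, if Q p t then (1 : ℝ) else 0 := by
            intro t
            have hnn : ∀ p ∈ Finset.univ, (0 : ℝ) ≤ if Q p t then (1 : ℝ) else 0 := fun p _ => by
              split_ifs <;> norm_num
            by_cases h : ω ∈ deactivation c m₀ E samp X S A t \ old t
            · rw [Set.indicator_of_mem h]
              obtain ⟨p, hp⟩ := exists_quadrupling_of_mem_deactivation hm (hω t h.1.1.1) h.1 h.2
              have := Finset.single_le_sum hnn (Finset.mem_univ p)
              rwa [if_pos (show Q p t from hp)] at this
            · rw [Set.indicator_of_notMem h]
              exact Finset.sum_nonneg hnn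
          refine (Finset.sum_le_sum fun t _ => hle t).trans ?_
          rw [Finset.sum_comm]
          calc ∑ p, ∑ t ∈ Finset.range T, (if Q p t then (1 : ℝ) else 0)
              ≤ ∑ _p : St × Ac, Real.log m := by
                refine Finset.sum_le_sum fun p _ => ?_
                rw [Finset.sum_boole]
                have h := card_quadrupling_le_log (fun u => X u ω)
                  (visits_counts_mono (S := S) (A := A) ω p.1 p.2) hm1 T
                simp only [held_comp (fun d => visits d p.1 p.2) (fun u => X u ω)
                  (fun u => counts S A u ω)] at h
                exact h
            _ = _ := by simp [Finset.card_univ]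
      _ = _ := by simp
  calc _ ≤ ∑ t ∈ Finset.range T, (γ ^ m₀ + P.real (deactivation c m₀ E samp X S A t \ old t)) :=
        Finset.sum_le_sum fun t _ => hsplit t
    _ ≤ _ := by
        rw [Finset.sum_add_distrib, Finset.sum_const, Finset.card_range, nsmul_eq_mul]
        linarith

/-- Almost every sampled environment has the properties that hold almost surely under the prior. -/
lemma IsRun.ae_samp {p : Env St Ac → Prop} (hp : ∀ᵐ M ∂prior, p M) :
    ∀ᵐ ω ∂P, ∀ t, p (samp t ω) := by
  set B := toMeasurable prior {M | ¬ p M} with hB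
  have hB0 : prior B = 0 := by rw [hB, measure_toMeasurable]; exact hp
  have hBm : MeasurableSet B := measurableSet_toMeasurable _ _
  have hE0 : P (E ⁻¹' B) = 0 := by
    rw [← Measure.map_apply hrun.measurable_env hBm, hrun.env_law, hB0]
  have hstart : ∀ t, ∀ᵐ ω ∂P, X t ω = false → samp t ω ∉ B := by
    intro t
    have h := congrArg (fun μ => μ (B ×ˢ Set.univ))
      (hrun.map_samp_eq_map_env t (measurable_state_hist S A t))
    beta_reduce at h
    rw [Measure.map_apply ((hrun.measurable_samp t).prodMk (hrun.measurable_state t))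
        (hBm.prod MeasurableSet.univ),
      Measure.map_apply (hrun.measurable_env.prodMk (hrun.measurable_state t))
        (hBm.prod MeasurableSet.univ)] at h
    have h2 : (P.restrict (X t ⁻¹' {false})) (samp t ⁻¹' B) = 0 := by
      have e1 : (fun ω => (samp t ω, S t ω)) ⁻¹' (B ×ˢ Set.univ) = samp t ⁻¹' B := by ext ω; simp
      have e2 : (fun ω => (E ω, S t ω)) ⁻¹' (B ×ˢ Set.univ) = E ⁻¹' B := by ext ω; simp
      rw [e1, e2] at h
      rw [h]
      exact Measure.absolutelyContinuous_of_le Measure.restrict_le_self hE0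
    have h3 : ∀ᵐ ω ∂P.restrict (X t ⁻¹' {false}), samp t ω ∉ B := by
      rw [ae_iff]
      simp only [not_not]
      exact h2
    exact (ae_restrict_iff' (hrun.measurableSet_coin t false)).1 h3
  have hall : ∀ᵐ ω ∂P, ∀ t, X t ω = false → samp t ω ∉ B := ae_all_iff.2 hstart
  have hkeep : ∀ᵐ ω ∂P, ∀ t, X (t + 1) ω = true → samp (t + 1) ω = samp t ω :=
    ae_all_iff.2 hrun.samp_keep
  filter_upwards [hall, hkeep, hrun.init_coin] with ω h2 h3 h4 t
  have hnot : samp t ω ∉ B := by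
    induction t with
    | zero => exact h2 0 h4
    | succ t ih =>
      by_cases hX : X (t + 1) ω = true
      · rw [h3 t hX]; exact ih
      · exact h2 (t + 1) (by simpa using hX)
  by_contra hcon
  exact hnot (subset_toMeasurable _ _ hcon)

/-- On active steps the model error is of the order of the inverse square root of the current
number of visits. -/
lemma sum_integral_modelErr_le (h0 : 0 ≤ γ) (h1 : γ < 1) {r : St → Ac → ℝ}
    (hr : ∀ s a, r s a ∈ Set.Icc (0 : ℝ) 1) (hplanner : Measurable planner)
    {τ : ℝ} (hτ : 0 ≤ τ)
    (hspan : ∀ᵐ M ∂prior, ∃ k : ℝ, ∀ s, |discValue γ r M (planner M) s - k| ≤ τ)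
    {c : ℝ} (hc : 1 ≤ c) (m₀ T : ℕ) :
    ∑ t ∈ Finset.range T, ∫ ω in active c m₀ E samp X S A t,
        modelErr γ r planner (E ω) (samp t ω) (S t ω) (A t ω) ∂P ≤
      8 * τ * c * √((Fintype.card St : ℝ) * Fintype.card Ac * T) := by
  set F : ℕ → Ω → ℝ := fun t ω =>
    1 / √((visits (counts S A t ω) (S t ω) (A t ω) : ℝ) + 1) with hF
  have hFm : ∀ t, Measurable (F t) := by
    intro t
    have hZ : Measurable (counts S A t) := (measurable_counts_past E samp X S A t).mono
      (hrun.pastSigma_le t) le_rfl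
    exact Measurable.comp (g := fun p : (St → Ac → St → ℕ) × St × Ac =>
      1 / √((visits p.1 p.2.1 p.2.2 : ℝ) + 1)) (f := fun ω => (counts S A t ω, S t ω, A t ω))
      (measurable_of_countable _)
      (hZ.prodMk ((hrun.measurable_state t).prodMk (hrun.measurable_action t)))
  have hF0 : ∀ t ω, 0 ≤ F t ω := fun t ω => by positivity
  have hFi : ∀ t, Integrable (F t) P := fun t => integrable_of_abs_le (c := 1) (hFm t) fun ω => by
    rw [abs_of_nonneg (hF0 t ω)]
    refine div_le_one_of_le₀ ?_ (Real.sqrt_nonneg _)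
    rw [Real.one_le_sqrt]
    linarith [Nat.cast_nonneg (α := ℝ) (visits (counts S A t ω) (S t ω) (A t ω))]
  have hEm : ∀ t, Measurable fun ω => modelErr γ r planner (E ω) (samp t ω) (S t ω) (A t ω) :=
    fun t => measurable_eval (F := fun a ω => modelErr γ r planner (E ω) (samp t ω) (S t ω) a)
      (fun a => measurable_eval (F := fun s ω => modelErr γ r planner (E ω) (samp t ω) s a)
        (fun s => measurable_modelErr hplanner hrun.measurable_env (hrun.measurable_samp t) s a)
        (hrun.measurable_state t)) (hrun.measurable_action t)
  have hEi : ∀ t, Integrable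
      (fun ω => modelErr γ r planner (E ω) (samp t ω) (S t ω) (A t ω)) P := fun t =>
    integrable_of_abs_le (hEm t) fun ω => abs_modelErr_le h0 h1 hr planner _ _ _ _
  have hactm := hrun.measurableSet_active c m₀
  have hterm : ∀ t, ∫ ω in active c m₀ E samp X S A t,
      modelErr γ r planner (E ω) (samp t ω) (S t ω) (A t ω) ∂P ≤ ∫ ω, 4 * τ * c * F t ω ∂P := by
    intro t
    rw [← integral_indicator (hactm t)]
    refine integral_mono_ae ((hEi t).indicator (hactm t)) ((hFi t).const_mul _) ?_
    filter_upwards [hrun.ae_samp hspan] with ω hω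
    by_cases h : ω ∈ active c m₀ E samp X S A t
    · rw [Set.indicator_of_mem h]
      obtain ⟨hEc, hsc, -, hv⟩ := h
      obtain ⟨k, hk⟩ := hω t
      set n := visits (counts S A t ω) (S t ω) (A t ω) with hn
      set w := max 1 (visits (heldCounts X S A t ω) (S t ω) (A t ω)) with hw
      have hnw : n + 1 ≤ 4 * w := hv (S t ω) (A t ω)
      have hnw' : (n : ℝ) + 1 ≤ 4 * w := by exact_mod_cast hnw
      have hw0 : (0 : ℝ) < w := by
        have : 0 < w := lt_of_lt_of_le one_pos (le_max_left _ _)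
        exact_mod_cast this
      have hsq : √((n : ℝ) + 1) ≤ 2 * √(w : ℝ) := by
        rw [show (2 : ℝ) * √(w : ℝ) = √(4 * w) by
          rw [Real.sqrt_mul (by norm_num), show (4 : ℝ) = 2 ^ 2 by norm_num,
            Real.sqrt_sq (by norm_num)]]
        exact Real.sqrt_le_sqrt hnw'
      have hsw : 0 < √(w : ℝ) := Real.sqrt_pos.2 hw0
      have hsn : 0 < √((n : ℝ) + 1) := Real.sqrt_pos.2 (by positivity)
      calc modelErr γ r planner (E ω) (samp t ω) (S t ω) (A t ω)
          ≤ τ * ∑ s', |(samp t ω).prob (S t ω) (A t ω) s' - (E ω).prob (S t ω) (A t ω) s'| :=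
            (le_abs_self _).trans (abs_modelErr_le_of_span planner _ _ hk)
        _ ≤ τ * (2 * c / √(w : ℝ)) :=
            mul_le_mul_of_nonneg_left (sum_abs_prob_sub_le hc hsc hEc _ _) hτ
        _ ≤ τ * (4 * c * (1 / √((n : ℝ) + 1))) := by
            refine mul_le_mul_of_nonneg_left ?_ hτ
            rw [mul_one_div, div_le_div_iff₀ hsw hsn]
            nlinarith
        _ = 4 * τ * c * F t ω := by simp only [hF, ← hn]; ring
    · rw [Set.indicator_of_notMem h]
      exact mul_nonneg (by positivity) (hF0 t ω)
  refine (Finset.sum_le_sum fun t _ => hterm t).trans ?_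
  rw [← integral_finsetSum _ fun t _ => (hFi t).const_mul _]
  calc _ ≤ ∫ _, 8 * τ * c * √((Fintype.card St : ℝ) * Fintype.card Ac * T) ∂P := by
        refine integral_mono_of_nonneg (Eventually.of_forall fun ω => Finset.sum_nonneg fun t _ =>
          mul_nonneg (by positivity) (hF0 t ω)) (integrable_const _)
          (Eventually.of_forall fun ω => ?_)
        have h := sum_inv_sqrt_count_le (fun j => (S j ω, A j ω)) T
        simp only [← visits_transCount (fun j => S j ω) (fun j => A j ω)] at h
        rw [Fintype.card_prod, Nat.cast_mul] at h
        simp only [← Finset.mul_sum]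
        have := mul_le_mul_of_nonneg_left h (show 0 ≤ 4 * τ * c by positivity)
        refine this.trans_eq ?_
        ring
    _ = _ := by simp

end Run

/-! ### Choice of the parameters -/

lemma pow_ceil_le {γ : ℝ} (h0 : 0 ≤ γ) (h1 : γ < 1) {T : ℝ} (hT : 0 < T) :
    γ ^ ⌈1 / (1 - γ) * Real.log (2 * T / (1 - γ))⌉₊ ≤ (1 - γ) / (2 * T) := by
  set m := 1 / (1 - γ) * Real.log (2 * T / (1 - γ)) with hm
  have hg : 0 < 1 - γ := by linarith
  have hle : γ ≤ Real.exp (-(1 - γ)) := by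
    have := Real.add_one_le_exp (-(1 - γ))
    linarith
  calc γ ^ ⌈m⌉₊ ≤ Real.exp (-(1 - γ)) ^ ⌈m⌉₊ := pow_le_pow_left₀ h0 hle _
    _ = Real.exp (⌈m⌉₊ * -(1 - γ)) := by rw [← Real.exp_nat_mul]
    _ ≤ Real.exp (-Real.log (2 * T / (1 - γ))) := by
        refine Real.exp_le_exp.2 ?_
        have h2 : m * (1 - γ) = Real.log (2 * T / (1 - γ)) := by rw [hm]; field_simp
        nlinarith [Nat.le_ceil m]
    _ = (1 - γ) / (2 * T) := by
        rw [Real.exp_neg, Real.exp_log (by positivity), inv_div]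

/-- With `c² = 4 S log (2 S A T)`, the failure probabilities of all confidence sets add up to at
most `1 / 2`. -/
lemma card_mul_exp_le {S A T : ℕ} (hS : 1 ≤ S) (hA : 1 ≤ A) (hT : 1 ≤ T) :
    2 * (T * ((S : ℝ) * A * 2 ^ S * T * Real.exp (-(4 * S * Real.log (2 * S * A * T) / 2)))) ≤
      1 := by
  have hS' : (1 : ℝ) ≤ S := by exact_mod_cast hS
  have hA' : (1 : ℝ) ≤ A := by exact_mod_cast hA
  have hT' : (1 : ℝ) ≤ T := by exact_mod_cast hT
  obtain ⟨k, rfl⟩ : ∃ k, S = k + 1 := ⟨S - 1, by omega⟩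
  set w : ℝ := ((k + 1 : ℕ) : ℝ) * A * T with hw
  have hSA : (1 : ℝ) ≤ ((k + 1 : ℕ) : ℝ) * A := one_le_mul_of_one_le_of_one_le hS' hA'
  have hw1 : 1 ≤ w := one_le_mul_of_one_le_of_one_le hSA hT'
  have hy : 2 * ((k + 1 : ℕ) : ℝ) * A * T = 2 * w := by rw [hw]; ring
  have hexp : Real.exp (-(4 * ((k + 1 : ℕ) : ℝ) * Real.log (2 * ((k + 1 : ℕ) : ℝ) * A * T) / 2))
      = ((2 * w) ^ (2 * (k + 1)))⁻¹ := by
    rw [hy, Real.exp_neg]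
    congr 1
    rw [← Real.exp_log (show 0 < 2 * w by linarith), ← Real.exp_nat_mul, Real.log_exp]
    congr 1
    push_cast
    ring
  rw [hexp, ← mul_assoc, ← mul_assoc, ← div_eq_mul_inv, div_le_one (by positivity)]
  -- `2 * S * A * T² * 2 ^ S ≤ w² * 2 ^ (2 * S) ≤ (2 * w) ^ (2 * S)`
  have e1 : ((k + 1 : ℕ) : ℝ) * A * T * T ≤ w ^ 2 := by
    rw [hw, mul_pow, sq (T : ℝ), mul_assoc]
    exact mul_le_mul_of_nonneg_right (by nlinarith) (by positivity)
  have e2 : w ^ 2 ≤ w ^ (2 * (k + 1)) := pow_le_pow_right₀ hw1 (by omega)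
  have e3 : (2 : ℝ) * 2 ^ (k + 1) ≤ 2 ^ (2 * (k + 1)) := by
    rw [← pow_succ']
    exact pow_le_pow_right₀ (by norm_num) (by omega)
  calc 2 * (T : ℝ) * (((k + 1 : ℕ) : ℝ) * A * 2 ^ (k + 1) * T)
      = (2 * 2 ^ (k + 1)) * (((k + 1 : ℕ) : ℝ) * A * T * T) := by ring
    _ ≤ 2 ^ (2 * (k + 1)) * w ^ (2 * (k + 1)) :=
        mul_le_mul e3 (e1.trans e2) (by positivity) (by positivity)
    _ = (2 * w) ^ (2 * (k + 1)) := (mul_pow _ _ _).symm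

end CPSRL

end

theorem theorem2 {Ω St Ac : Type*} [Fintype St] [DecidableEq St] [MeasurableSpace St]
    [MeasurableSingletonClass St] [Fintype Ac] [DecidableEq Ac] [MeasurableSpace Ac]
    [MeasurableSingletonClass Ac] [MeasurableSpace Ω]
    (P : Measure Ω) [IsProbabilityMeasure P]
    (γ : ℝ) (hγ0 : 0 ≤ γ) (hγ1 : γ < 1)
    (r : St → Ac → ℝ) (hr : ∀ s a, r s a ∈ Set.Icc (0 : ℝ) 1)
    (prior : Measure (CPSRL.Env St Ac)) (τ : ℝ≥0)
    (hprior : ∀ᵐ M ∂prior,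
      CPSRL.IsWeaklyCommunicating M ∧ CPSRL.optRewardAvgTime γ r M ≤ (τ : ℝ≥0∞))
    (s₀ : St)
    (planner : CPSRL.Env St Ac → CPSRL.Policy St Ac) (hplanner : Measurable planner)
    (hopt : ∀ M, CPSRL.IsDiscOptimal γ r M (planner M))
    (E : Ω → CPSRL.Env St Ac) (samp : ℕ → Ω → CPSRL.Env St Ac) (X : ℕ → Ω → Bool)
    (S : ℕ → Ω → St) (A : ℕ → Ω → Ac)
    (hrun : CPSRL.IsRun P γ prior s₀ planner E samp X S A)
    (T : ℕ) (hT : 1 ≤ T) (hm : 1 ≤ 1 / (1 - γ) * Real.log (2 * T / (1 - γ))) :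
    Integrable (CPSRL.discRegret γ r planner E samp X S T) P ∧
    ∫ ω, CPSRL.discRegret γ r planner E samp X S T ω ∂P ≤
      (4 * (τ : ℝ) + 2) * (Fintype.card St : ℝ) *
          Real.sqrt (28 * (Fintype.card Ac : ℝ) * T *
            Real.log (2 * (Fintype.card St : ℝ) * (Fintype.card Ac : ℝ) * T)) +
        (Fintype.card St : ℝ) * (Fintype.card Ac : ℝ) / (1 - γ) *
          Real.log (1 / (1 - γ) * Real.log (2 * T / (1 - γ))) +
        1 / 2 + 2 / (1 - γ) := by
  have hne : Nonempty St := ⟨s₀⟩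
  have hΩ : Nonempty Ω := P.nonempty_of_neZero
  have hneA : Nonempty Ac := ⟨A 0 hΩ.some⟩
  refine ⟨(CPSRL.integral_discRegret hγ0 hγ1 hr hplanner hrun hopt T).1, ?_⟩
  obtain ⟨T', rfl⟩ : ∃ T', T = T' + 1 := ⟨T - 1, by omega⟩
  have hg : 0 < 1 - γ := by linarith
  have hcS : 1 ≤ Fintype.card St := Fintype.card_pos
  have hcA : 1 ≤ Fintype.card Ac := Fintype.card_pos
  have hT' : (1 : ℝ) ≤ ((T' + 1 : ℕ) : ℝ) := by exact_mod_cast hT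
  have hS1 : (1 : ℝ) ≤ Fintype.card St := by exact_mod_cast hcS
  have hA1 : (1 : ℝ) ≤ Fintype.card Ac := by exact_mod_cast hcA
  have hexp := CPSRL.card_mul_exp_le hcS hcA hT
  set nS : ℝ := (Fintype.card St : ℝ) with hnS
  set nA : ℝ := (Fintype.card Ac : ℝ) with hnA
  set nT : ℝ := ((T' + 1 : ℕ) : ℝ) with hnT
  set m := 1 / (1 - γ) * Real.log (2 * nT / (1 - γ)) with hmdef
  set L := Real.log (2 * nS * nA * nT) with hL
  have hSAT : 1 ≤ nS * nA * nT :=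
    one_le_mul_of_one_le_of_one_le (one_le_mul_of_one_le_of_one_le hS1 hA1) hT'
  have hL2 : 1 / 4 ≤ L := by
    have h2 : Real.log 2 ≤ L := Real.log_le_log (by norm_num) (by linarith)
    linarith [Real.log_two_gt_d9]
  have hc0 : 1 ≤ 4 * nS * L := by nlinarith
  set c := √(4 * nS * L) with hc
  have hc1 : 1 ≤ c := Real.one_le_sqrt.2 hc0
  have hc2 : c ^ 2 = 4 * nS * L := Real.sq_sqrt (by linarith)
  have hm₀ : 0 < ⌈m⌉₊ := Nat.ceil_pos.2 (by linarith)
  have hspan : ∀ᵐ M ∂prior, ∃ k : ℝ,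
      ∀ s, |CPSRL.discValue γ r M (planner M) s - k| ≤ (τ : ℝ) := by
    filter_upwards [hprior] with M hM
    obtain ⟨k, hk⟩ := CPSRL.exists_abs_optDiscValue_sub_le hγ0 hγ1 hr hM.1 hM.2
    exact ⟨k, fun s => by rw [hopt M s]; exact hk s⟩
  have hmain := CPSRL.integral_discRegret_le hrun hγ0 hγ1 hr hplanner hopt c ⌈m⌉₊ T'
  have herr := CPSRL.sum_integral_modelErr_le hrun hγ0 hγ1 hr hplanner τ.2 hspan hc1 ⌈m⌉₊ (T' + 1)
  have hdeact := hrun.sum_prob_deactivation_le hγ0 c hm (Nat.ceil_lt_add_one (by linarith)) T'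
  have hbad : ∑ t ∈ Finset.range (T' + 1),
      P.real (X t ⁻¹' {false} \ CPSRL.active c ⌈m⌉₊ E samp X S A t) ≤ (1 - γ) * 1 := by
    calc _ ≤ ∑ t ∈ Finset.range (T' + 1), 2 * ((1 - γ) *
          (nS * nA * 2 ^ Fintype.card St * nT * Real.exp (-(4 * nS * L / 2)))) := by
          refine Finset.sum_le_sum fun t ht => (hrun.prob_start_inactive_le c hm₀ t).trans ?_
          refine mul_le_mul_of_nonneg_left (mul_le_mul_of_nonneg_left ?_ hg.le) (by norm_num)
          refine (hrun.prob_notMem_confSet_le (zero_le_one.trans hc1) t).trans ?_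
          rw [hc2]
          have : (t : ℝ) ≤ nT := Nat.cast_le.2 (Finset.mem_range.1 ht).le
          gcongr
      _ = (1 - γ) * (2 * (nT * (nS * nA * 2 ^ Fintype.card St * nT *
          Real.exp (-(4 * nS * L / 2))))) := by
          rw [Finset.sum_const, Finset.card_range, nsmul_eq_mul]
          ring
      _ ≤ (1 - γ) * 1 := mul_le_mul_of_nonneg_left hexp hg.le
  have hpow := CPSRL.pow_ceil_le hγ0 hγ1 (zero_lt_one.trans_le hT')
  have hage : T' * γ ^ ⌈m⌉₊ ≤ (1 - γ) * (1 / 2) := by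
    have h1 : (T' : ℝ) ≤ nT := by rw [hnT]; push_cast; linarith
    calc T' * γ ^ ⌈m⌉₊ ≤ nT * ((1 - γ) / (2 * nT)) :=
          mul_le_mul h1 hpow (pow_nonneg hγ0 _) (by linarith)
      _ = (1 - γ) * (1 / 2) := by field_simp
  -- `c * √(S A T) = 2 S √(A T L)`, and `8 * 2 * τ ≤ (4 τ + 2) * √28`
  have hlead : 8 * (τ : ℝ) * c * √(nS * nA * nT) ≤ (4 * τ + 2) * nS * √(28 * nA * nT * L) := by
    have hx : 0 ≤ nA * nT * L := by positivity
    have e1 : c * √(nS * nA * nT) = 2 * nS * √(nA * nT * L) := by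
      rw [hc, ← Real.sqrt_mul (by linarith), show 4 * nS * L * (nS * nA * nT)
        = (2 * nS) ^ 2 * (nA * nT * L) by ring, Real.sqrt_mul (by positivity),
        Real.sqrt_sq (by linarith)]
    have e2 : 4 * √(nA * nT * L) ≤ √(28 * nA * nT * L) := by
      rw [show (4 : ℝ) = √(4 ^ 2) by rw [Real.sqrt_sq (by norm_num)], ← Real.sqrt_mul (by norm_num)]
      exact Real.sqrt_le_sqrt (by linarith)
    have hτ : 0 ≤ (τ : ℝ) := τ.2
    have h3 := mul_le_mul_of_nonneg_left e2 (show 0 ≤ (4 * (τ : ℝ) + 2) * nS by positivity)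
    calc 8 * (τ : ℝ) * c * √(nS * nA * nT) = 16 * τ * (nS * √(nA * nT * L)) := by
          rw [mul_assoc _ c, e1]; ring
      _ ≤ (16 * τ + 8) * (nS * √(nA * nT * L)) :=
          mul_le_mul_of_nonneg_right (by linarith) (by positivity)
      _ = (4 * τ + 2) * nS * (4 * √(nA * nT * L)) := by ring
      _ ≤ _ := h3
  have hB : 0 ≤ (4 * (τ : ℝ) + 2) * nS * √(28 * nA * nT * L) := by positivity
  have hmodel := (mul_le_mul_of_nonneg_left (herr.trans hlead) hγ0).trans
    (mul_le_of_le_one_left hB hγ1.le)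
  have hrest : 1 / (1 - γ) * (1 + ∑ t ∈ Finset.range T',
      P.real (CPSRL.deactivation c ⌈m⌉₊ E samp X S A t) + ∑ t ∈ Finset.range (T' + 1),
        P.real (X t ⁻¹' {false} \ CPSRL.active c ⌈m⌉₊ E samp X S A t)) ≤
      nS * nA / (1 - γ) * Real.log m + 1 / 2 + 2 / (1 - γ) := by
    have hb1 : 1 ≤ 1 / (1 - γ) := (one_le_div hg).2 (by linarith)
    calc _ ≤ 1 / (1 - γ) * (1 + ((1 - γ) * (1 / 2) + nS * nA * Real.log m) + (1 - γ) * 1) :=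
          mul_le_mul_of_nonneg_left (by linarith) (by positivity)
      _ = nS * nA / (1 - γ) * Real.log m + 1 / 2 + 1 / (1 - γ) + 1 := by field_simp; ring
      _ ≤ _ := by
          have : 2 / (1 - γ) = 1 / (1 - γ) + 1 / (1 - γ) := by ring
          linarith
  linarith
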